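/- Let $\Omega\subset\mathbb R^N$ be open, $T>0$, $Q=\Omega\times(0,T)$, and let $p:\Omega\to\mathbb R$ be a measurable exponent with $1<p^-:=\operatorname{ess\,inf}_\Omega p\le p^+:=\operatorname{ess\,sup}_\Omega p<\infty$; put $p'(x)=p(x)/(p(x)-1)$. Let $V=L^{p(x)}(\Omega)$ and $\mathcal V=L^{p(x)}(Q)$ be the variable exponent Lebesgue spaces (classes of measurable functions $u$ with $\int|u|^{p(x)}<\infty$, with the Luxemburg norm), with duals $V^*=L^{p'(x)}(\Omega)$, $\mathcal V^*=L^{p'(x)}(Q)$ under the pairings $\int_\Omega \xi v\,dx$ and $\iint_Q\xi v\,dx\,dt$. For a function $u$ on $Q$ write $Pu(t)=u(\cdot,t)$; if $u\in\mathcal V$ then $Pu(t)\in V$ for a.e. $t$, and similarly for $\mathcal V^*$ and $V^*$. Let $\varphi:V\to[0,\infty]$ be proper ($\varphi\not\equiv\infty$), convex and lower semicontinuous, and define $\Phi:\mathcal V\to[0,\infty]$ by $\Phi(u)=\int_0^T\varphi(Pu(t))\,dt$ if $t\mapsto\varphi(Pu(t))$ belongs to $L^1(0,T)$ and $\Phi(u)=\infty$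 otherwise. For $\lambda>0$ define the modified Moreau–Yosida regularizations $$\varphi_\lambda(w)=\min_{v\in V}\Big(\int_\Omega\frac{\lambda}{p(x)}\Big|\frac{v(x)-w(x)}{\lambda}\Big|^{p(x)}dx+\varphi(v)\Big)\quad(w\in V),$$ $$\Phi_\lambda(u)=\min_{v\in\mathcal V}\Big(\iint_Q\frac{\lambda}{p(x)}\Big|\frac{v(x,t)-u(x,t)}{\lambda}\Big|^{p(x)}dx\,dt+\Phi(v)\Big)\quad(u\in\mathcal V).$$ For a functional $F:V\to[0,\infty]$ and $w\in V$ with $F(w)<\infty$ let $\partial_\Omega F(w)$ be the set of $\xi\in V^*$ with $F(v)-F(w)\ge\int_\Omega\xi(v-w)\,dx$ for all $v\in V$ with $F(v)<\infty$ (and $\partial_\Omega F(w)=\emptyset$ if $F(w)=\infty$); $\partial_Q$ is defined in the same way on $\mathcal V$. Then both minima are attained and finite for all $w\in V$ and $u\in\mathcal V$; for every $u\in\mathcal V$ the function $t\mapsto\varphi_\lambda(Pu(t))$ is measurable on $(0,T)$ and $$\Phi_\lambda(u)=\int_0^T\varphi_\lambda(Pu(t))\,dt .$$ Moreover, $\partial_\Omega\varphi_\lambda$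 and $\partial_Q\Phi_\lambda$ are single-valued and defined on all of $V$ and of $\mathcal V$, respectively, and for all $u\in\mathcal V$ and $\xi_\lambda\in\mathcal V^*$, $$\xi_\lambda=\partial_Q\Phi_\lambda(u)\quad\Longleftrightarrow\quad P\xi_\lambda(t)=\partial_\Omega\varphi_\lambda(Pu(t))\ \text{ for a.e. } t\in(0,T).$$ -/

import Mathlib

open MeasureTheory Set
open scoped ENNReal NNReal

noncomputable section

/-- A measurable variable exponent `p` on the measure space `(α, μ)` with `1 < p⁻ ≤ p⁺ < ∞`, where
`p⁻` and `p⁺` are the essential infimum and the essential supremum of `p`. -/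
structure VarExponent {α : Type*} [MeasurableSpace α] (μ : Measure α) where
  toFun : α → ℝ
  aemeasurable' : AEMeasurable toFun μ
  bounds' : ∃ a b : ℝ, 1 < a ∧ a ≤ b ∧ ∀ᵐ x ∂μ, a ≤ toFun x ∧ toFun x ≤ b

namespace VarExponent

variable {α τ : Type*} [MeasurableSpace α] [MeasurableSpace τ] {μ : Measure α}

instance : CoeFun (VarExponent μ) (fun _ => α → ℝ) := ⟨VarExponent.toFun⟩

/-- The conjugate exponent `p'(x) = p(x) / (p(x) - 1)`. -/
def conj (p : VarExponent μ) : VarExponent μ where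
  toFun x := p x / (p x - 1)
  aemeasurable' := p.aemeasurable'.div (p.aemeasurable'.sub aemeasurable_const)
  bounds' := by
    obtain ⟨a, b, ha, hab, h⟩ := p.bounds'
    have key : ∀ s t : ℝ, 1 < s → s ≤ t → t / (t - 1) ≤ s / (s - 1) := by
      intro s t hs hst
      rw [div_le_div_iff₀ (by linarith) (by linarith)]
      nlinarith
    refine ⟨b / (b - 1), a / (a - 1), ?_, key a b ha hab, ?_⟩
    · rw [lt_div_iff₀ (by linarith)]
      linarith
    · filter_upwards [h] with x hx
      exact ⟨key _ _ (by linarith [hx.1]) hx.2, key _ _ ha hx.1⟩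

/-- The exponent `(x, t) ↦ p(x)` on the product space. -/
def ext (p : VarExponent μ) (ν : Measure τ) [SFinite ν] : VarExponent (μ.prod ν) where
  toFun z := p z.1
  aemeasurable' := p.aemeasurable'.comp_quasiMeasurePreserving Measure.quasiMeasurePreserving_fst
  bounds' := by
    obtain ⟨a, b, ha, hab, h⟩ := p.bounds'
    exact ⟨a, b, ha, hab, Measure.quasiMeasurePreserving_fst.ae h⟩

/-- The modular `∫ |f(x)|^{p(x)} dμ(x)`. -/
def modular (p : VarExponent μ) (f : α → ℝ) : ℝ≥0∞ :=
  ∫⁻ x, ENNReal.ofReal (|f x| ^ p x) ∂μ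

theorem modular_congr (p : VarExponent μ) {f g : α → ℝ} (h : f =ᵐ[μ] g) :
    p.modular f = p.modular g := by
  refine lintegral_congr_ae ?_
  filter_upwards [h] with x hx
  rw [hx]

theorem aemeasurable_pow (p : VarExponent μ) {f : α → ℝ} (hf : AEMeasurable f μ) :
    AEMeasurable (fun x => ENNReal.ofReal (|f x| ^ p x)) μ := by
  have hf' : AEMeasurable (fun x => |f x|) μ := by simpa [Real.norm_eq_abs] using hf.norm
  exact (hf'.pow p.aemeasurable').ennreal_ofReal

theorem modular_zero (p : VarExponent μ) : p.modular (fun _ => 0) = 0 := by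
  obtain ⟨a, b, ha, hab, h⟩ := p.bounds'
  unfold modular
  rw [lintegral_eq_zero_iff' (p.aemeasurable_pow aemeasurable_const)]
  filter_upwards [h] with x hx
  have : p x ≠ 0 := by linarith [hx.1]
  simp [Real.zero_rpow this]

/-- Scaling by an arbitrary constant keeps the modular finite. -/
theorem modular_smul_lt_top (p : VarExponent μ) (c : ℝ) {f : α → ℝ} (hf : p.modular f < ∞) :
    p.modular (fun x => c * f x) < ∞ := by
  obtain ⟨a, b, ha, hab, h⟩ := p.bounds'
  have : p.modular (fun x => c * f x) ≤ ENNReal.ofReal ((max |c| 1) ^ b) * p.modular f := by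
    unfold modular
    rw [← lintegral_const_mul' _ _ ENNReal.ofReal_ne_top]
    refine lintegral_mono_ae ?_
    filter_upwards [h] with x hx
    rw [← ENNReal.ofReal_mul (by positivity)]
    refine ENNReal.ofReal_le_ofReal ?_
    rw [abs_mul, Real.mul_rpow (abs_nonneg _) (abs_nonneg _)]
    refine mul_le_mul_of_nonneg_right ?_ (by positivity)
    calc |c| ^ p x ≤ (max |c| 1) ^ p x :=
          Real.rpow_le_rpow (abs_nonneg _) (le_max_left _ _) (by linarith [hx.1])
      _ ≤ _ := Real.rpow_le_rpow_of_exponent_le (le_max_right _ _) hx.2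
  exact this.trans_lt (ENNReal.mul_lt_top ENNReal.ofReal_lt_top hf)

/-- Scaling by a constant in `[0, 1]` shrinks the modular at least linearly. -/
theorem modular_smul_le (p : VarExponent μ) {c : ℝ} (h0 : 0 ≤ c) (h1 : c ≤ 1) (f : α → ℝ) :
    p.modular (fun x => c * f x) ≤ ENNReal.ofReal c * p.modular f := by
  obtain ⟨a, b, ha, hab, h⟩ := p.bounds'
  unfold modular
  rw [← lintegral_const_mul' _ _ ENNReal.ofReal_ne_top]
  refine lintegral_mono_ae ?_
  filter_upwards [h] with x hx
  rw [← ENNReal.ofReal_mul h0]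
  refine ENNReal.ofReal_le_ofReal ?_
  rw [abs_mul, Real.mul_rpow (abs_nonneg _) (abs_nonneg _), abs_of_nonneg h0]
  refine mul_le_mul_of_nonneg_right ?_ (by positivity)
  exact Real.rpow_le_self_of_le_one h0 h1 (by linarith [hx.1])

/-- Convexity of the modular. -/
theorem modular_convex (p : VarExponent μ) {s t : ℝ} (hs : 0 ≤ s) (ht : 0 ≤ t) (hst : s + t = 1)
    {f g : α → ℝ} (hf : AEMeasurable f μ) :
    p.modular (fun x => s * f x + t * g x)
      ≤ ENNReal.ofReal s * p.modular f + ENNReal.ofReal t * p.modular g := by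
  obtain ⟨a, b, ha, hab, h⟩ := p.bounds'
  unfold modular
  rw [← lintegral_const_mul' _ _ ENNReal.ofReal_ne_top,
    ← lintegral_const_mul' _ _ ENNReal.ofReal_ne_top,
    ← lintegral_add_left' ((p.aemeasurable_pow hf).const_mul _)]
  refine lintegral_mono_ae ?_
  filter_upwards [h] with x hx
  rw [← ENNReal.ofReal_mul hs, ← ENNReal.ofReal_mul ht,
    ← ENNReal.ofReal_add (by positivity) (by positivity)]
  refine ENNReal.ofReal_le_ofReal ?_
  have hp : 1 ≤ p x := by linarith [hx.1]
  calc |s * f x + t * g x| ^ p x ≤ (s * |f x| + t * |g x|) ^ p x := by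
        refine Real.rpow_le_rpow (abs_nonneg _) ?_ (by linarith)
        refine (abs_add_le _ _).trans ?_
        rw [abs_mul, abs_mul, abs_of_nonneg hs, abs_of_nonneg ht]
    _ ≤ _ := (convexOn_rpow hp).2 (abs_nonneg (f x)) (abs_nonneg (g x)) hs ht hst

theorem modular_add_lt_top (p : VarExponent μ) {f g : α → ℝ} (hfm : AEMeasurable f μ)
    (hf : p.modular f < ∞) (hg : p.modular g < ∞) : p.modular (fun x => f x + g x) < ∞ := by
  have h := p.modular_convex (s := 1 / 2) (t := 1 / 2) (by norm_num) (by norm_num) (by norm_num)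
    (f := fun x => 2 * f x) (g := fun x => 2 * g x) (hfm.const_mul 2)
  have e : (fun x => 1 / 2 * (2 * f x) + 1 / 2 * (2 * g x)) = fun x => f x + g x := by
    funext x; ring
  rw [e] at h
  exact h.trans_lt (ENNReal.add_lt_top.2
    ⟨ENNReal.mul_lt_top ENNReal.ofReal_lt_top (p.modular_smul_lt_top 2 hf),
      ENNReal.mul_lt_top ENNReal.ofReal_lt_top (p.modular_smul_lt_top 2 hg)⟩)

end VarExponent

/-- The variable exponent Lebesgue space `L^{p(x)}(μ)`: classes of a.e. equal measurable functions
`u` with `∫ |u(x)|^{p(x)} dμ(x) < ∞`. -/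
def VarLp {α : Type*} [MeasurableSpace α] {μ : Measure α} (p : VarExponent μ) :
    Submodule ℝ (α →ₘ[μ] ℝ) where
  carrier := {u | p.modular u < ∞}
  zero_mem' := by
    change p.modular _ < ∞
    rw [p.modular_congr (AEEqFun.coeFn_zero (α := α) (β := ℝ) (μ := μ)), Pi.zero_def,
      p.modular_zero]
    exact ENNReal.zero_lt_top
  add_mem' := by
    intro u v hu hv
    change p.modular _ < ∞
    rw [p.modular_congr (AEEqFun.coeFn_add u v)]
    exact p.modular_add_lt_top u.aemeasurable hu hv
  smul_mem' := by
    intro c u hu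
    change p.modular _ < ∞
    rw [p.modular_congr (AEEqFun.coeFn_smul c u)]
    exact p.modular_smul_lt_top c hu

namespace VarLp

variable {α : Type*} [MeasurableSpace α] {μ : Measure α} {p : VarExponent μ}

instance : CoeFun (VarLp p) (fun _ => α → ℝ) := ⟨fun u => ((u : α →ₘ[μ] ℝ) : α → ℝ)⟩

/-- The Luxemburg norm. -/
instance : Norm (VarLp p) :=
  ⟨fun u => sInf {k : ℝ | 0 < k ∧ p.modular (fun x => u x / k) ≤ 1}⟩

theorem norm_def (u : VarLp p) :
    ‖u‖ = sInf {k : ℝ | 0 < k ∧ p.modular (fun x => u x / k) ≤ 1} := rfl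

theorem lux_bddBelow (u : VarLp p) :
    BddBelow {k : ℝ | 0 < k ∧ p.modular (fun x => u x / k) ≤ 1} := ⟨0, fun _ hk => hk.1.le⟩

theorem lux_nonempty (u : VarLp p) :
    {k : ℝ | 0 < k ∧ p.modular (fun x => u x / k) ≤ 1}.Nonempty := by
  have hu : p.modular u ≠ ∞ := ne_of_lt u.2
  set M := (p.modular u).toReal with hM
  have hM0 : 0 ≤ M := ENNReal.toReal_nonneg
  refine ⟨M + 1, by positivity, ?_⟩
  have e : (fun x => u x / (M + 1)) = fun x => (M + 1)⁻¹ * u x := by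
    funext x; rw [div_eq_inv_mul]
  rw [e]
  refine (p.modular_smul_le (by positivity) (inv_le_one_of_one_le₀ (by linarith)) _).trans ?_
  rw [← ENNReal.ofReal_toReal hu, ← ENNReal.ofReal_mul (by positivity), ← hM,
    ENNReal.ofReal_le_one, inv_mul_le_iff₀ (by positivity)]
  linarith

theorem lux_nonneg (u : VarLp p) : 0 ≤ ‖u‖ := Real.sInf_nonneg fun _ hk => hk.1.le

theorem lux_add (u v : VarLp p) : ‖u + v‖ ≤ ‖u‖ + ‖v‖ := by
  refine le_of_forall_pos_le_add fun ε hε => ?_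
  obtain ⟨k, ⟨hk, hku⟩, hk'⟩ :=
    exists_lt_of_csInf_lt (lux_nonempty u) (show sInf _ < ‖u‖ + ε / 2 from by
      rw [← norm_def]; linarith)
  obtain ⟨l, ⟨hl, hlv⟩, hl'⟩ :=
    exists_lt_of_csInf_lt (lux_nonempty v) (show sInf _ < ‖v‖ + ε / 2 from by
      rw [← norm_def]; linarith)
  have : ‖u + v‖ ≤ k + l := by
    refine csInf_le (lux_bddBelow _) ⟨by positivity, ?_⟩
    have hc : (fun x => (u + v : VarLp p) x / (k + l)) =ᵐ[μ]
        fun x => k / (k + l) * (u x / k) + l / (k + l) * (v x / l) := by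
      filter_upwards [AEEqFun.coeFn_add (u : α →ₘ[μ] ℝ) v] with x hx
      have hx' : (u + v : VarLp p) x = u x + v x := by simpa using hx
      rw [hx']
      field_simp
    rw [p.modular_congr hc]
    have hkl : 0 ≤ k / (k + l) := by positivity
    have hlk : 0 ≤ l / (k + l) := by positivity
    have hone : k / (k + l) + l / (k + l) = 1 := by field_simp
    refine (p.modular_convex hkl hlk hone
      ((u : α →ₘ[μ] ℝ).aemeasurable.div_const k)).trans ?_
    calc _ ≤ ENNReal.ofReal (k / (k + l)) * 1 + ENNReal.ofReal (l / (k + l)) * 1 := by gcongr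
      _ = 1 := by rw [mul_one, mul_one, ← ENNReal.ofReal_add hkl hlk, hone, ENNReal.ofReal_one]
  linarith

theorem lux_zero : ‖(0 : VarLp p)‖ = 0 := by
  refine le_antisymm (le_of_forall_pos_le_add fun ε hε => ?_) (lux_nonneg _)
  rw [zero_add]
  refine csInf_le (lux_bddBelow _) ⟨hε, ?_⟩
  have hc : (fun x => (0 : VarLp p) x / ε) =ᵐ[μ] fun _ => 0 := by
    filter_upwards [AEEqFun.coeFn_zero (α := α) (β := ℝ) (μ := μ)] with x hx
    have hx' : (0 : VarLp p) x = 0 := by simpa using hx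
    rw [hx', zero_div]
  rw [p.modular_congr hc, p.modular_zero]
  exact zero_le_one

theorem lux_smul_le {c : ℝ} (hc : c ≠ 0) (u : VarLp p) : ‖c • u‖ ≤ |c| * ‖u‖ := by
  have hc' : 0 < |c| := abs_pos.2 hc
  rw [← div_le_iff₀' hc']
  refine le_csInf (lux_nonempty u) fun k hk => ?_
  rw [div_le_iff₀' hc']
  refine csInf_le (lux_bddBelow _) ⟨mul_pos hc' hk.1, ?_⟩
  refine le_trans (le_of_eq ?_) hk.2
  refine lintegral_congr_ae ?_
  filter_upwards [AEEqFun.coeFn_smul c (u : α →ₘ[μ] ℝ)] with x hx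
  have hx' : (c • u : VarLp p) x = c * u x := by simpa using hx
  simp only [hx', abs_div, abs_mul, abs_abs]
  rw [mul_div_mul_left _ _ hc'.ne']

theorem lux_smul (c : ℝ) (u : VarLp p) : ‖c • u‖ = |c| * ‖u‖ := by
  rcases eq_or_ne c 0 with rfl | hc
  · rw [zero_smul, lux_zero, abs_zero, zero_mul]
  · refine le_antisymm (lux_smul_le hc u) ?_
    have h := lux_smul_le (inv_ne_zero hc) (c • u)
    rw [smul_smul, inv_mul_cancel₀ hc, one_smul, abs_inv] at h
    rwa [← le_inv_mul_iff₀ (abs_pos.2 hc)]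

theorem lux_eq_zero (u : VarLp p) (hu : ‖u‖ = 0) : u = 0 := by
  have hmod : p.modular u = 0 := by
    refine le_antisymm (ENNReal.le_of_forall_pos_le_add fun ε hε _ => ?_) (zero_le)
    have hlt : sInf {k : ℝ | 0 < k ∧ p.modular (fun x => u x / k) ≤ 1} < min (ε : ℝ) 1 := by
      rw [← norm_def, hu]
      exact lt_min (by exact_mod_cast hε) one_pos
    obtain ⟨k, ⟨hk, hku⟩, hk'⟩ := exists_lt_of_csInf_lt (lux_nonempty u) hlt
    have e : (u : α → ℝ) = fun x => k * (u x / k) := by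
      funext x; field_simp
    rw [e, zero_add]
    refine (p.modular_smul_le hk.le (hk'.le.trans (min_le_right _ _)) _).trans ?_
    calc _ ≤ ENNReal.ofReal k * 1 := by gcongr
      _ ≤ ε := by
        rw [mul_one, ← ENNReal.ofReal_coe_nnreal]
        exact ENNReal.ofReal_le_ofReal (hk'.le.trans (min_le_left _ _))
  unfold VarExponent.modular at hmod
  rw [lintegral_eq_zero_iff' (p.aemeasurable_pow (u : α →ₘ[μ] ℝ).aemeasurable)] at hmod
  refine Subtype.ext (AEEqFun.ext ?_)
  filter_upwards [hmod, AEEqFun.coeFn_zero (α := α) (β := ℝ) (μ := μ)] with x hx h0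
  have hx1 : |u x| ^ p x ≤ 0 := by simpa using hx
  have hx2 : u x = 0 := by
    by_contra hne
    exact absurd (Real.rpow_pos_of_pos (abs_pos.2 hne) (p x)) (not_lt.2 hx1)
  rw [hx2]
  simpa using h0.symm

theorem normCore : NormedSpace.Core ℝ (VarLp p) where
  norm_nonneg := lux_nonneg
  norm_smul := lux_smul
  norm_triangle := lux_add
  norm_eq_zero_iff u := ⟨lux_eq_zero u, fun h => h ▸ lux_zero⟩

instance : NormedAddCommGroup (VarLp p) := NormedAddCommGroup.ofCore normCore

instance : NormedSpace ℝ (VarLp p) := NormedSpace.ofCore normCore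

end VarLp

section Functionals

variable {α : Type*} [MeasurableSpace α] {μ : Measure α} {p : VarExponent μ}

/-- The subdifferential of `F : L^{p(x)} → [0, ∞]` at `u`, as a subset of `L^{p'(x)}`, with respect
to the pairing `⟨ξ, v⟩ = ∫ ξ v dμ`; it is empty if `F u = ∞`. -/
def subdiff (F : VarLp p → ℝ≥0∞) (u : VarLp p) : Set (VarLp p.conj) :=
  {ξ | F u ≠ ∞ ∧ ∀ v : VarLp p, F v ≠ ∞ →
    ∫ x, ξ x * (v x - u x) ∂μ ≤ (F v).toReal - (F u).toReal}

/-- The quantity `∫ (λ / p(x)) |(v(x) - u(x)) / λ|^{p(x)} dμ(x) + F(v)` that is minimized over `v`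
in the modified Moreau-Yosida regularization. -/
def yosidaObjective (lam : ℝ) (F : VarLp p → ℝ≥0∞) (u v : VarLp p) : ℝ≥0∞ :=
  (∫⁻ x, ENNReal.ofReal (lam / p x * |(v x - u x) / lam| ^ p x) ∂μ) + F v

/-- The modified Moreau-Yosida regularization `F_λ` of `F`. -/
def moreauYosida (lam : ℝ) (F : VarLp p → ℝ≥0∞) (u : VarLp p) : ℝ≥0∞ :=
  ⨅ v : VarLp p, yosidaObjective lam F u v

end Functionals

section TimeDependence

variable {α τ : Type*} [MeasurableSpace α] [MeasurableSpace τ] {μ : Measure α} {ν : Measure τ}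

/-- The slice `u(·, t)` of a measurable function `u` of `(x, t)`. -/
def timeSlice (u : (α × τ) →ₘ[μ.prod ν] ℝ) (t : τ) : α →ₘ[μ] ℝ :=
  AEEqFun.mk (fun x => u (x, t))
    (u.stronglyMeasurable.comp_measurable measurable_prodMk_right).aestronglyMeasurable

open Classical in
/-- The pointwise evaluation `Pu(t) = u(·, t)` as an element of `L^{p(x)}(μ)`. For
`u ∈ L^{p(x)}(μ ⊗ ν)` the slice belongs to `L^{p(x)}(μ)` for a.e. `t`; on the remaining null set
the value is `0`. -/
def evalP [SFinite ν] (p : VarExponent μ) (u : VarLp (p.ext ν)) (t : τ) : VarLp p :=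
  if h : timeSlice (u : (α × τ) →ₘ[μ.prod ν] ℝ) t ∈ VarLp p then ⟨_, h⟩ else 0

theorem evalP_coeFn [SFinite μ] [SFinite ν] (p : VarExponent μ) (u : VarLp (p.ext ν)) :
    ∀ᵐ t ∂ν, (evalP p u t : α → ℝ) =ᵐ[μ] fun x => u (x, t) := by
  have hu : ∫⁻ z, ENNReal.ofReal (|u z| ^ (p.ext ν) z) ∂(μ.prod ν) < ∞ := u.2
  have hm := (p.ext ν).aemeasurable_pow (u : (α × τ) →ₘ[μ.prod ν] ℝ).aemeasurable
  rw [lintegral_prod_symm _ hm] at hu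
  filter_upwards [ae_lt_top' hm.lintegral_prod_left' hu.ne] with t ht
  have hcoe : (timeSlice (u : (α × τ) →ₘ[μ.prod ν] ℝ) t : α → ℝ) =ᵐ[μ] fun x => u (x, t) :=
    AEEqFun.coeFn_mk _ _
  have hmem : timeSlice (u : (α × τ) →ₘ[μ.prod ν] ℝ) t ∈ VarLp p := by
    change p.modular _ < ∞
    rw [p.modular_congr hcoe]
    exact ht
  rw [evalP, dif_pos hmem]
  exact hcoe

open Classical in
/-- The functional `Φ(u) = ∫ φ(Pu(t)) dν(t)` if `t ↦ φ(Pu(t))` is integrable, and `Φ(u) = ∞`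
otherwise. -/
def timeIntegral (ν : Measure τ) [SFinite ν] {p : VarExponent μ} (φ : VarLp p → ℝ≥0∞)
    (u : VarLp (p.ext ν)) : ℝ≥0∞ :=
  if AEMeasurable (fun t => φ (evalP p u t)) ν ∧ ∫⁻ t, φ (evalP p u t) ∂ν < ∞ then
    ∫⁻ t, φ (evalP p u t) ∂ν
  else ∞

end TimeDependence

/-- Lebesgue measure on `(0, T)`. -/
abbrev timeMeasure (T : ℝ) : Measure ℝ := volume.restrict (Ioo 0 T)

end

/-! Write K(z) = ∫ (λ/p)|z/λ|^p for the kinetic term and G(z) = |z/λ|^(p-2) z/λ for its gradient.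
Let F be convex, lower semicontinuous and proper. K is uniformly convex in the modular sense, so
minimizing sequences of K(v - w) + F(v) are Cauchy and a minimizer exists by completeness
(`VarLp.exists_moreauYosida_eq`). A point v is a minimizer exactly when -G(v - w) ∈ ∂F(v)
(`VarLp.neg_kineticGrad_mem_subdiff`, `VarLp.moreauYosida_eq_of_mem_subdiff`), and then ∂F_λ(w) =
{-G(v - w)} (`VarLp.subdiff_moreauYosida_eq`).

The integral functional Φ is again convex, lower semicontinuous and proper, so all this applies to Φ
as well as to φ. If v minimizes for Φ at u, then -G(v - u) ∈ ∂Φ(v). Testing with competitors altered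
only on a set of times localizes this inclusion to a.e. t (`ae_evalP_mem_subdiff`). Since G acts
pointwise it commutes with slicing, so Pv(t) minimizes for φ at Pu(t) for a.e. t. No measurable
selection of minimizers is needed. Integrating the minimal values gives the formula for Φ_λ, and
both subdifferentials are the same expression -G, read on Q and on slices.

Completeness and separability of L^{p(x)} are transported from L² by u ↦ |u|^(p/2) sgn u, which is
uniformly continuous on balls and has a continuous inverse. -/

section

open Filter Topology

/-! ### Scalar inequalities for signed powers and uniform convexity of powers. -/

/-- The odd extension of the power `r ↦ r ^ q` from `[0, ∞)` to the real line. -/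
noncomputable def spow (r q : ℝ) : ℝ := max r 0 ^ q - max (-r) 0 ^ q

theorem spow_of_nonneg {r q : ℝ} (hr : 0 ≤ r) (hq : q ≠ 0) : spow r q = r ^ q := by
  rw [spow, max_eq_left hr, max_eq_right (by linarith), Real.zero_rpow hq, sub_zero]

theorem spow_neg (r q : ℝ) : spow (-r) q = -spow r q := by
  rw [spow, spow, neg_neg, neg_sub]

theorem spow_zero_left (q : ℝ) : spow 0 q = 0 := by simp [spow]

theorem abs_spow (r : ℝ) {q : ℝ} (hq : q ≠ 0) : |spow r q| = |r| ^ q := by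
  rcases le_total 0 r with hr | hr
  · rw [spow_of_nonneg hr hq, abs_of_nonneg hr, abs_of_nonneg (by positivity)]
  · obtain ⟨x, rfl⟩ : ∃ x, r = -x := ⟨-r, by ring⟩
    have hx : 0 ≤ x := by linarith
    rw [spow_neg, abs_neg, abs_neg, spow_of_nonneg hx hq, abs_of_nonneg hx,
      abs_of_nonneg (by positivity)]

theorem spow_mul {m : ℝ} (hm : 0 ≤ m) (r q : ℝ) : spow (m * r) q = m ^ q * spow r q := by
  have h1 : ∀ x : ℝ, max (m * x) 0 = m * max x 0 := fun x => by
    rw [mul_max_of_nonneg _ _ hm, mul_zero]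
  rw [spow, spow, ← mul_neg, h1, h1, Real.mul_rpow hm (le_max_right _ _),
    Real.mul_rpow hm (le_max_right _ _), mul_sub]

theorem spow_spow (r : ℝ) {q s : ℝ} (hq : q ≠ 0) (hs : s ≠ 0) :
    spow (spow r q) s = spow r (q * s) := by
  rcases le_total 0 r with hr | hr
  · rw [spow_of_nonneg hr hq, spow_of_nonneg (by positivity) hs,
      spow_of_nonneg hr (mul_ne_zero hq hs), Real.rpow_mul hr]
  · obtain ⟨x, rfl⟩ : ∃ x, r = -x := ⟨-r, by ring⟩
    have hx : 0 ≤ x := by linarith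
    rw [spow_neg, spow_neg, spow_neg, spow_of_nonneg hx hq, spow_of_nonneg (by positivity) hs,
      spow_of_nonneg hx (mul_ne_zero hq hs), Real.rpow_mul hx]

theorem spow_one (r : ℝ) : spow r 1 = r := by
  rcases le_total 0 r with hr | hr
  · rw [spow_of_nonneg hr one_ne_zero, Real.rpow_one]
  · obtain ⟨x, rfl⟩ : ∃ x, r = -x := ⟨-r, by ring⟩
    rw [spow_neg, spow_of_nonneg (by linarith) one_ne_zero, Real.rpow_one]

theorem spow_mul_self (r : ℝ) {q : ℝ} (hq : 0 < q) : spow r q * r = |r| ^ (q + 1) := by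
  have key : ∀ x : ℝ, 0 ≤ x → spow x q * x = |x| ^ (q + 1) := fun x hx => by
    rw [spow_of_nonneg hx hq.ne', abs_of_nonneg hx, Real.rpow_add' hx (by linarith), Real.rpow_one]
  rcases le_total 0 r with hr | hr
  · exact key r hr
  · have := key (-r) (by linarith)
    rwa [spow_neg, neg_mul_neg, abs_neg] at this

theorem continuousAt_spow {z : ℝ × ℝ} (hz : 0 < z.2) :
    ContinuousAt (fun z : ℝ × ℝ => spow z.1 z.2) z := by
  unfold spow
  refine ContinuousAt.sub ?_ ?_
  · exact ContinuousAt.rpow (f := fun z : ℝ × ℝ => max z.1 0) (g := fun z => z.2) (by fun_prop)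
      (by fun_prop) (Or.inr hz)
  · exact ContinuousAt.rpow (f := fun z : ℝ × ℝ => max (-z.1) 0) (g := fun z => z.2) (by fun_prop)
      (by fun_prop) (Or.inr hz)

theorem measurable_spow : Measurable fun z : ℝ × ℝ => spow z.1 z.2 := by
  unfold spow
  fun_prop

/-- Where G ≥ ε, a compact set, H cannot vanish, so it has a positive minimum there, and a large
multiple of H dominates the bounded function G. Elsewhere ε alone suffices. -/
theorem IsCompact.exists_le_add_mul {X : Type*} [TopologicalSpace X] [T2Space X] {K : Set X}
    (hK : IsCompact K) {G H : X → ℝ} (hG : ContinuousOn G K) (hH : ContinuousOn H K)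
    (h0 : ∀ x ∈ K, 0 ≤ H x) (hz : ∀ x ∈ K, H x = 0 → G x ≤ 0) {ε : ℝ} (hε : 0 < ε) :
    ∃ C, 0 ≤ C ∧ ∀ x ∈ K, G x ≤ ε + C * H x := by
  have hK' : IsCompact (K ∩ G ⁻¹' Ici ε) :=
    hK.of_isClosed_subset (hG.preimage_isClosed_of_isClosed hK.isClosed isClosed_Ici)
      inter_subset_left
  rcases (K ∩ G ⁻¹' Ici ε).eq_empty_or_nonempty with he | hne
  · refine ⟨0, le_rfl, fun x hx => ?_⟩
    by_contra! hlt
    have : x ∈ K ∩ G ⁻¹' Ici ε := ⟨hx, by simpa using hlt.le⟩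
    rw [he] at this
    exact this
  · obtain ⟨x₀, hx₀, hmin⟩ := hK'.exists_isMinOn hne (hH.mono inter_subset_left)
    obtain ⟨M, hM⟩ := hK.bddAbove_image hG
    have hpos : 0 < H x₀ := by
      refine lt_of_le_of_ne (h0 _ hx₀.1) fun h => ?_
      have h1 := hz _ hx₀.1 h.symm
      have h2 : ε ≤ G x₀ := hx₀.2
      linarith
    refine ⟨max M 0 / H x₀, by positivity, fun x hx => ?_⟩
    rcases le_or_gt ε (G x) with h | h
    · have h1 : H x₀ ≤ H x := hmin ⟨hx, h⟩
      have h2 : G x ≤ M := hM ⟨x, hx, rfl⟩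
      calc G x ≤ max M 0 := h2.trans (le_max_left _ _)
        _ = max M 0 / H x₀ * H x₀ := by field_simp
        _ ≤ max M 0 / H x₀ * H x := by gcongr
        _ ≤ _ := by linarith
    · have : 0 ≤ max M 0 / H x₀ * H x := mul_nonneg (by positivity) (h0 x hx)
      linarith

/-- Every pair of reals is a nonnegative multiple of a pair of maximum norm one. -/
theorem exists_mul_sphere (s t : ℝ) : ∃ m s' t' : ℝ, 0 ≤ m ∧ s = m * s' ∧ t = m * t' ∧
    (s', t') ∈ Metric.sphere (0 : ℝ × ℝ) 1 ∧ ∀ q : ℝ, 0 < q → m ^ q ≤ |s| ^ q + |t| ^ q := by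
  have hle : ∀ q : ℝ, 0 < q → max |s| |t| ^ q ≤ |s| ^ q + |t| ^ q := fun q hq => by
    have h1 : 0 ≤ |s| ^ q := by positivity
    have h2 : 0 ≤ |t| ^ q := by positivity
    rcases le_total |s| |t| with h | h
    · rw [max_eq_right h]; linarith
    · rw [max_eq_left h]; linarith
  rcases eq_or_ne (max |s| |t|) 0 with h0 | h0
  · have hs : |s| ≤ 0 := h0 ▸ le_max_left _ _
    have ht : |t| ≤ 0 := h0 ▸ le_max_right _ _
    rw [abs_nonpos_iff] at hs ht
    -- Here s = t = 0, so any point of the sphere will do with factor zero.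
    refine ⟨0, 1, 1, le_rfl, by simp [hs], by simp [ht], by simp, fun q hq => ?_⟩
    have := hle q hq
    rwa [h0] at this
  · have hpos : 0 < max |s| |t| := lt_of_le_of_ne (by positivity) h0.symm
    refine ⟨max |s| |t|, s / max |s| |t|, t / max |s| |t|, hpos.le, by field_simp, by field_simp,
      ?_, hle⟩
    rw [mem_sphere_zero_iff_norm, Prod.norm_mk, Real.norm_eq_abs, Real.norm_eq_abs, abs_div,
      abs_div, abs_of_pos hpos, max_div_div_right hpos.le, div_self h0]

/-- All terms are homogeneous of degree q in (s, t), so only the unit sphere times a compact box of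
exponents matters. There the left side vanishes wherever s = t, and compactness gives C. Integrated,
this yields the continuity of the maps `VarLp.signedPow`. -/
theorem abs_spow_sub_spow_le {a b c d : ℝ} (ha : 0 < a) (hc : 0 < c) {ε : ℝ} (hε : 0 < ε) :
    ∃ C, 0 ≤ C ∧ ∀ s t q r : ℝ, q ∈ Icc a b → r ∈ Icc c d →
      |spow s (q / r) - spow t (q / r)| ^ r ≤ ε * (|s| ^ q + |t| ^ q) + C * |s - t| ^ q := by
  have hK : IsCompact (Metric.sphere (0 : ℝ × ℝ) 1 ×ˢ (Icc a b ×ˢ Icc c d)) :=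
    (isCompact_sphere _ _).prod (isCompact_Icc.prod isCompact_Icc)
  have hpos : ∀ z ∈ Metric.sphere (0 : ℝ × ℝ) 1 ×ˢ (Icc a b ×ˢ Icc c d),
      0 < z.2.1 ∧ 0 < z.2.2 := fun z hz => ⟨ha.trans_le hz.2.1.1, hc.trans_le hz.2.2.1⟩
  obtain ⟨C, hC, h⟩ : ∃ C, 0 ≤ C ∧ ∀ z ∈ Metric.sphere (0 : ℝ × ℝ) 1 ×ˢ (Icc a b ×ˢ Icc c d),
      |spow z.1.1 (z.2.1 / z.2.2) - spow z.1.2 (z.2.1 / z.2.2)| ^ z.2.2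
        ≤ ε + C * |z.1.1 - z.1.2| ^ z.2.1 := by
    refine hK.exists_le_add_mul ?_ ?_ ?_ ?_ hε
    · intro z hz
      obtain ⟨h1, h2⟩ := hpos z hz
      have hd : 0 < z.2.1 / z.2.2 := by positivity
      have hdc : ContinuousAt (fun z : (ℝ × ℝ) × ℝ × ℝ => z.2.1 / z.2.2) z :=
        ContinuousAt.div (by fun_prop) (by fun_prop) h2.ne'
      have e1 : ContinuousAt (fun z : (ℝ × ℝ) × ℝ × ℝ => spow z.1.1 (z.2.1 / z.2.2)) z :=
        ContinuousAt.comp (f := fun z : (ℝ × ℝ) × ℝ × ℝ => (z.1.1, z.2.1 / z.2.2))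
          (g := fun w : ℝ × ℝ => spow w.1 w.2) (continuousAt_spow hd)
          (ContinuousAt.prodMk (by fun_prop) hdc)
      have e2 : ContinuousAt (fun z : (ℝ × ℝ) × ℝ × ℝ => spow z.1.2 (z.2.1 / z.2.2)) z :=
        ContinuousAt.comp (f := fun z : (ℝ × ℝ) × ℝ × ℝ => (z.1.2, z.2.1 / z.2.2))
          (g := fun w : ℝ × ℝ => spow w.1 w.2) (continuousAt_spow hd)
          (ContinuousAt.prodMk (by fun_prop) hdc)
      exact (ContinuousAt.rpow (g := fun z : (ℝ × ℝ) × ℝ × ℝ => z.2.2) (e1.sub e2).abs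
        (by fun_prop) (Or.inr h2)).continuousWithinAt
    · intro z hz
      exact (ContinuousAt.rpow (f := fun z : (ℝ × ℝ) × ℝ × ℝ => |z.1.1 - z.1.2|)
        (g := fun z => z.2.1) (by fun_prop) (by fun_prop)
        (Or.inr (hpos z hz).1)).continuousWithinAt
    · intro z _
      positivity
    · intro z hz h
      obtain ⟨h1, h2⟩ := hpos z hz
      rw [Real.rpow_eq_zero (abs_nonneg _) h1.ne', abs_eq_zero, sub_eq_zero] at h
      simp only [h, sub_self, abs_zero]
      rw [Real.zero_rpow h2.ne']
  refine ⟨C, hC, fun s t q r hq hr => ?_⟩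
  have hq0 : 0 < q := ha.trans_le hq.1
  have hr0 : 0 < r := hc.trans_le hr.1
  obtain ⟨m, s', t', hm, rfl, rfl, hmem, hmq⟩ := exists_mul_sphere s t
  have h1 := h ((s', t'), (q, r)) ⟨hmem, hq, hr⟩
  simp only at h1
  have h2 := hmq q hq0
  rw [spow_mul hm, spow_mul hm, ← mul_sub, ← mul_sub m, abs_mul (m ^ (q / r)),
    abs_mul m (s' - t'), Real.mul_rpow (abs_nonneg _) (abs_nonneg _),
    Real.mul_rpow (abs_nonneg m) (abs_nonneg (s' - t')),
    abs_of_nonneg hm, abs_of_nonneg (show 0 ≤ m ^ (q / r) by positivity), ← Real.rpow_mul hm,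
    div_mul_cancel₀ _ hr0.ne']
  calc m ^ q * |spow s' (q / r) - spow t' (q / r)| ^ r
      ≤ m ^ q * (ε + C * |s' - t'| ^ q) := by gcongr
    _ = ε * m ^ q + C * (m ^ q * |s' - t'| ^ q) := by ring
    _ ≤ _ := by
      gcongr

theorem abs_midpoint_rpow_le {q : ℝ} (hq : 1 < q) (s t : ℝ) :
    |(s + t) / 2| ^ q ≤ (|s| ^ q + |t| ^ q) / 2 := by
  have h2 : |(s + t) / 2| ≤ (1 / 2) * |s| + (1 / 2) * |t| := by
    rw [abs_div, abs_of_pos (show (0 : ℝ) < 2 by norm_num)]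
    linarith [abs_add_le s t]
  have h := (convexOn_rpow hq.le).2 (abs_nonneg s) (abs_nonneg t)
    (show (0 : ℝ) ≤ 1 / 2 by norm_num) (show (0 : ℝ) ≤ 1 / 2 by norm_num) (by norm_num)
  simp only [smul_eq_mul] at h
  have h3 := Real.rpow_le_rpow (abs_nonneg _) h2 (by linarith : 0 ≤ q)
  linarith

/-- Strict convexity on the half-line excludes |s| ≠ |t|. In the remaining case s = -t the midpoint
is zero, which forces t = 0. -/
theorem eq_of_abs_midpoint_rpow_eq {q : ℝ} (hq : 1 < q) {s t : ℝ}
    (h : (|s| ^ q + |t| ^ q) / 2 - |(s + t) / 2| ^ q = 0) : s = t := by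
  by_contra hne
  have h2 : |(s + t) / 2| ≤ (1 / 2) * |s| + (1 / 2) * |t| := by
    rw [abs_div, abs_of_pos (show (0 : ℝ) < 2 by norm_num)]
    linarith [abs_add_le s t]
  rcases eq_or_ne |s| |t| with he | he
  · rcases abs_eq_abs.1 he with h' | h'
    · exact hne h'
    · subst h'
      have ht : t ≠ 0 := fun h0 => hne (by simp [h0])
      have hp : 0 < |t| ^ q := Real.rpow_pos_of_pos (abs_pos.2 ht) _
      rw [neg_add_cancel, zero_div, abs_zero, Real.zero_rpow (by linarith), abs_neg] at h
      linarith
  · have h1 := (strictConvexOn_rpow hq).2 (abs_nonneg s) (abs_nonneg t) he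
      (show (0 : ℝ) < 1 / 2 by norm_num) (show (0 : ℝ) < 1 / 2 by norm_num) (by norm_num)
    simp only [smul_eq_mul] at h1
    have h3 := Real.rpow_le_rpow (abs_nonneg _) h2 (by linarith : 0 ≤ q)
    linarith

/-- Uniform convexity of `|·| ^ q`, uniformly in `q` in a compact subinterval of `(1, ∞)`. -/
theorem abs_sub_rpow_le {a b : ℝ} (ha : 1 < a) {ε : ℝ} (hε : 0 < ε) :
    ∃ C, 0 ≤ C ∧ ∀ s t q : ℝ, q ∈ Icc a b → |s - t| ^ q ≤
      ε * (|s| ^ q + |t| ^ q) + C * ((|s| ^ q + |t| ^ q) / 2 - |(s + t) / 2| ^ q) := by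
  have hK : IsCompact (Metric.sphere (0 : ℝ × ℝ) 1 ×ˢ Icc a b) :=
    (isCompact_sphere _ _).prod isCompact_Icc
  have hone : ∀ z ∈ Metric.sphere (0 : ℝ × ℝ) 1 ×ˢ Icc a b, 1 < z.2 := fun z hz =>
    ha.trans_le hz.2.1
  have hpos : ∀ z ∈ Metric.sphere (0 : ℝ × ℝ) 1 ×ˢ Icc a b, 0 < z.2 := fun z hz => by
    linarith [hone z hz]
  obtain ⟨C, hC, h⟩ : ∃ C, 0 ≤ C ∧ ∀ z ∈ Metric.sphere (0 : ℝ × ℝ) 1 ×ˢ Icc a b,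
      |z.1.1 - z.1.2| ^ z.2 ≤ ε + C *
        ((|z.1.1| ^ z.2 + |z.1.2| ^ z.2) / 2 - |(z.1.1 + z.1.2) / 2| ^ z.2) := by
    -- The role of H is played by the midpoint deficit: nonnegative by convexity, zero only for s =
    -- t by strict convexity.
    refine hK.exists_le_add_mul ?_ ?_ ?_ ?_ hε
    · intro z hz
      exact (ContinuousAt.rpow (by fun_prop) (by fun_prop) (Or.inr (hpos z hz))).continuousWithinAt
    · intro z hz
      have c : ∀ f : (ℝ × ℝ) × ℝ → ℝ, Continuous f → ContinuousAt (fun z => |f z| ^ z.2) z :=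
        fun f hf => ContinuousAt.rpow (by fun_prop) (by fun_prop) (Or.inr (hpos z hz))
      exact ((((c _ (by fun_prop)).add (c _ (by fun_prop))).div_const 2).sub
        (c _ (by fun_prop))).continuousWithinAt
    · intro z hz
      linarith [abs_midpoint_rpow_le (hone z hz) z.1.1 z.1.2]
    · intro z hz h
      have := eq_of_abs_midpoint_rpow_eq (hone z hz) h
      simp only [this, sub_self, abs_zero]
      rw [Real.zero_rpow (hpos z hz).ne']
  refine ⟨C, hC, fun s t q hq => ?_⟩
  have hq0 : 0 < q := by linarith [hq.1]
  obtain ⟨m, s', t', hm, rfl, rfl, hmem, hmq⟩ := exists_mul_sphere s t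
  have h1 := h ((s', t'), q) ⟨hmem, hq⟩
  simp only at h1
  have hmul : ∀ x, |m * x| ^ q = m ^ q * |x| ^ q := fun x => by
    rw [abs_mul, Real.mul_rpow (abs_nonneg _) (abs_nonneg _), abs_of_nonneg hm]
  have h2 := hmq q hq0
  rw [← mul_sub, ← mul_add, mul_div_assoc, hmul, hmul, hmul, hmul] at *
  calc m ^ q * |s' - t'| ^ q ≤ m ^ q * (ε + C * ((|s'| ^ q + |t'| ^ q) / 2 -
        |(s' + t') / 2| ^ q)) := by gcongr
    _ = ε * m ^ q + C * ((m ^ q * |s'| ^ q + m ^ q * |t'| ^ q) / 2 -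
        m ^ q * |(s' + t') / 2| ^ q) := by ring
    _ ≤ _ := by gcongr

/-! ### Comparison of the modular with the Luxemburg norm. -/

namespace VarExponent

variable {α : Type*} [MeasurableSpace α] {μ : Measure α}

/-- The constant is independent of f because p⁺ < ∞. This uniformity is what makes small modular
imply small norm. -/
theorem exists_modular_mul_le (p : VarExponent μ) (c : ℝ) :
    ∃ C : ℝ, 0 < C ∧ ∀ f : α → ℝ,
      p.modular (fun x => c * f x) ≤ ENNReal.ofReal C * p.modular f := by
  obtain ⟨a, b, ha, hab, h⟩ := p.bounds'
  refine ⟨(max |c| 1) ^ b, by positivity, fun f => ?_⟩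
  unfold modular
  rw [← lintegral_const_mul' _ _ ENNReal.ofReal_ne_top]
  refine lintegral_mono_ae ?_
  filter_upwards [h] with x hx
  rw [← ENNReal.ofReal_mul (by positivity)]
  refine ENNReal.ofReal_le_ofReal ?_
  rw [abs_mul, Real.mul_rpow (abs_nonneg _) (abs_nonneg _)]
  refine mul_le_mul_of_nonneg_right ?_ (by positivity)
  calc |c| ^ p x ≤ (max |c| 1) ^ p x :=
        Real.rpow_le_rpow (abs_nonneg _) (le_max_left _ _) (by linarith [hx.1])
    _ ≤ _ := Real.rpow_le_rpow_of_exponent_le (le_max_right _ _) hx.2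

/-- The constant exponent two. -/
noncomputable def two (μ : Measure α) : VarExponent μ where
  toFun _ := 2
  aemeasurable' := aemeasurable_const
  bounds' := ⟨2, 2, by norm_num, le_rfl, by simp⟩

end VarExponent

namespace VarLp

variable {α : Type*} [MeasurableSpace α] {μ : Measure α} {p q : VarExponent μ}

theorem aemeasurable (u : VarLp p) : AEMeasurable u μ := (u : α →ₘ[μ] ℝ).aemeasurable

theorem aestronglyMeasurable (u : VarLp p) : AEStronglyMeasurable u μ :=
  (u : α →ₘ[μ] ℝ).aestronglyMeasurable

theorem modular_lt_top (u : VarLp p) : p.modular u < ∞ := u.2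

theorem coeFn_add (u v : VarLp p) : (u + v : VarLp p) =ᵐ[μ] fun x => u x + v x :=
  AEEqFun.coeFn_add (u : α →ₘ[μ] ℝ) v

theorem coeFn_sub (u v : VarLp p) : (u - v : VarLp p) =ᵐ[μ] fun x => u x - v x :=
  AEEqFun.coeFn_sub (u : α →ₘ[μ] ℝ) v

theorem coeFn_smul (c : ℝ) (u : VarLp p) : (c • u : VarLp p) =ᵐ[μ] fun x => c * u x :=
  AEEqFun.coeFn_smul c (u : α →ₘ[μ] ℝ)

theorem ext_ae {u v : VarLp p} (h : (u : α → ℝ) =ᵐ[μ] v) : u = v := Subtype.ext (AEEqFun.ext h)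

/-- The class of a measurable function with finite modular. -/
noncomputable def of (f : α → ℝ) (hf : AEStronglyMeasurable f μ) (h : p.modular f < ∞) : VarLp p :=
  ⟨AEEqFun.mk f hf, by
    change p.modular _ < ∞
    rwa [p.modular_congr (AEEqFun.coeFn_mk f hf)]⟩

theorem coeFn_of (f : α → ℝ) (hf : AEStronglyMeasurable f μ) (h : p.modular f < ∞) :
    (of f hf h : VarLp p) =ᵐ[μ] f := AEEqFun.coeFn_mk f hf

theorem modular_sub_eq (u v : VarLp p) :
    p.modular (u - v : VarLp p) = p.modular fun x => u x - v x := p.modular_congr (coeFn_sub u v)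

theorem norm_le_of_modular {u : VarLp p} {k : ℝ} (hk : 0 < k)
    (h : p.modular (fun x => k⁻¹ * u x) ≤ 1) : ‖u‖ ≤ k := by
  refine csInf_le (lux_bddBelow u) ⟨hk, ?_⟩
  simpa only [div_eq_inv_mul] using h

theorem modular_le_one_of_norm_lt {u : VarLp p} {k : ℝ} (h : ‖u‖ < k) :
    p.modular (fun x => k⁻¹ * u x) ≤ 1 := by
  have hk : 0 < k := (norm_nonneg u).trans_lt h
  obtain ⟨l, ⟨hl, hlu⟩, hlk⟩ := exists_lt_of_csInf_lt (lux_nonempty u) (h : sInf _ < k)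
  have e : (fun x => k⁻¹ * u x) = fun x => l / k * (u x / l) := by
    funext x; field_simp
  rw [e]
  refine (p.modular_smul_le (by positivity) ((div_le_one hk).2 hlk.le) _).trans ?_
  calc _ ≤ 1 * p.modular (fun x => u x / l) := by
        gcongr
        rw [ENNReal.ofReal_le_one]
        exact (div_le_one hk).2 hlk.le
    _ ≤ 1 := by rwa [one_mul]

theorem modular_le_of_norm_lt {u : VarLp p} {k : ℝ} (h : ‖u‖ < k) (hk1 : k ≤ 1) :
    p.modular u ≤ ENNReal.ofReal k := by
  have hk : 0 < k := (norm_nonneg u).trans_lt h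
  have e : (u : α → ℝ) = fun x => k * (k⁻¹ * u x) := by
    funext x; field_simp
  rw [e]
  refine (p.modular_smul_le hk.le hk1 _).trans ?_
  calc _ ≤ ENNReal.ofReal k * 1 := by
        gcongr
        exact modular_le_one_of_norm_lt h
    _ = _ := mul_one _

theorem exists_modular_le_of_norm_lt (p : VarExponent μ) {R : ℝ} (hR : 0 < R) :
    ∃ C : ℝ, 0 < C ∧ ∀ u : VarLp p, ‖u‖ < R → p.modular u ≤ ENNReal.ofReal C := by
  obtain ⟨C, hC, h⟩ := p.exists_modular_mul_le R
  refine ⟨C, hC, fun u hu => ?_⟩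
  have e : (u : α → ℝ) = fun x => R * (R⁻¹ * u x) := by
    funext x; field_simp
  rw [e]
  refine (h _).trans ?_
  calc _ ≤ ENNReal.ofReal C * 1 := by
        gcongr
        exact modular_le_one_of_norm_lt hu
    _ = _ := mul_one _

theorem exists_norm_le_of_modular_le (p : VarExponent μ) {ε : ℝ} (hε : 0 < ε) :
    ∃ δ : ℝ, 0 < δ ∧ ∀ u : VarLp p, p.modular u ≤ ENNReal.ofReal δ → ‖u‖ ≤ ε := by
  obtain ⟨C, hC, h⟩ := p.exists_modular_mul_le ε⁻¹
  refine ⟨C⁻¹, by positivity, fun u hu => norm_le_of_modular hε ((h _).trans ?_)⟩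
  calc _ ≤ ENNReal.ofReal C * ENNReal.ofReal C⁻¹ := by gcongr
    _ = 1 := by
      rw [← ENNReal.ofReal_mul hC.le, mul_inv_cancel₀ hC.ne', ENNReal.ofReal_one]

/-- Later limits are handled through modulars, which are integrals and so compatible with Tonelli,
rather than through the infimum defining the norm. -/
theorem tendsto_iff_modular {ι : Type*} {l : Filter ι} {f : ι → VarLp p} {u : VarLp p} :
    Tendsto f l (𝓝 u) ↔ Tendsto (fun i => p.modular fun x => f i x - u x) l (𝓝 0) := by
  simp_rw [← modular_sub_eq]
  rw [tendsto_iff_norm_sub_tendsto_zero, ENNReal.tendsto_nhds_zero, Metric.tendsto_nhds]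
  constructor
  · intro h ε hε
    rcases eq_or_ne ε ∞ with rfl | hne
    · simp
    have hpos : 0 < min ε.toReal 1 := lt_min (ENNReal.toReal_pos hε.ne' hne) one_pos
    filter_upwards [h _ hpos] with i hi
    rw [dist_zero_right, norm_norm] at hi
    refine (modular_le_of_norm_lt hi (min_le_right _ _)).trans ?_
    exact ENNReal.ofReal_le_of_le_toReal (min_le_left _ _)
  · intro h ε hε
    obtain ⟨δ, hδ, hd⟩ := exists_norm_le_of_modular_le p (half_pos hε)
    filter_upwards [h _ (ENNReal.ofReal_pos.2 hδ)] with i hi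
    rw [dist_zero_right, norm_norm]
    linarith [hd _ hi]

theorem cauchySeq_of_modular {u : ℕ → VarLp p}
    (h : ∀ δ : ℝ, 0 < δ → ∃ n₀, ∀ m ≥ n₀, ∀ n ≥ n₀,
      p.modular (fun x => u m x - u n x) ≤ ENNReal.ofReal δ) : CauchySeq u := by
  rw [Metric.cauchySeq_iff]
  intro ε hε
  obtain ⟨δ, hδ, hd⟩ := exists_norm_le_of_modular_le p (half_pos hε)
  obtain ⟨n₀, hn⟩ := h δ hδ
  refine ⟨n₀, fun m hm n hn' => ?_⟩
  rw [dist_eq_norm]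
  have := hd (u m - u n) (by rw [modular_sub_eq]; exact hn m hm n hn')
  linarith

/-! ### Signed power maps between spaces of different exponents. -/

theorem modular_spow (p q : VarExponent μ) (f : α → ℝ) :
    q.modular (fun x => spow (f x) (p x / q x)) = p.modular f := by
  obtain ⟨a, b, ha, hab, h⟩ := p.bounds'
  obtain ⟨c, d, hc, hcd, h'⟩ := q.bounds'
  refine lintegral_congr_ae ?_
  filter_upwards [h, h'] with x hx hx'
  have h1 : 0 < p x := by linarith [hx.1]
  have h2 : 0 < q x := by linarith [hx'.1]
  rw [abs_spow _ (by positivity), ← Real.rpow_mul (abs_nonneg _), div_mul_cancel₀ _ h2.ne']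

/-- The superposition map `u ↦ |u| ^ (p / q) sgn u` from `L^{p(x)}` to `L^{q(x)}`. -/
noncomputable def signedPow (p q : VarExponent μ) (u : VarLp p) : VarLp q :=
  of (fun x => spow (u x) (p x / q x))
    (measurable_spow.comp_aemeasurable
      ((aemeasurable u).prodMk (p.aemeasurable'.div q.aemeasurable'))).aestronglyMeasurable
    (by rw [modular_spow]; exact modular_lt_top u)

theorem coeFn_signedPow (p q : VarExponent μ) (u : VarLp p) :
    signedPow p q u =ᵐ[μ] fun x => spow (u x) (p x / q x) := coeFn_of _ _ _

theorem signedPow_signedPow (p q : VarExponent μ) (u : VarLp p) :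
    signedPow q p (signedPow p q u) = u := by
  obtain ⟨a, b, ha, hab, h⟩ := p.bounds'
  obtain ⟨c, d, hc, hcd, h'⟩ := q.bounds'
  refine ext_ae ?_
  filter_upwards [h, h', coeFn_signedPow q p (signedPow p q u), coeFn_signedPow p q u]
    with x hx hx' h1 h2
  have h3 : 0 < p x := by linarith [hx.1]
  have h4 : 0 < q x := by linarith [hx'.1]
  rw [h1, h2, spow_spow _ (by positivity) (by positivity),
    show p x / q x * (q x / p x) = 1 by field_simp, spow_one]

theorem exists_modular_signedPow_sub_le (p q : VarExponent μ) {ε : ℝ} (hε : 0 < ε) :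
    ∃ C : ℝ, 0 ≤ C ∧ ∀ u v : VarLp p, q.modular (signedPow p q u - signedPow p q v : VarLp q) ≤
      ENNReal.ofReal ε * (p.modular u + p.modular v) +
        ENNReal.ofReal C * p.modular (u - v : VarLp p) := by
  obtain ⟨a, b, ha, hab, h⟩ := p.bounds'
  obtain ⟨c, d, hc, hcd, h'⟩ := q.bounds'
  obtain ⟨C, hC, hle⟩ := abs_spow_sub_spow_le (a := a) (b := b) (c := c) (d := d)
    (by linarith) (by linarith) hε
  refine ⟨C, hC, fun u v => ?_⟩
  rw [modular_sub_eq, modular_sub_eq]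
  unfold VarExponent.modular
  have hu := p.aemeasurable_pow (VarLp.aemeasurable u)
  have hv := p.aemeasurable_pow (VarLp.aemeasurable v)
  have huv : AEMeasurable (fun x => ENNReal.ofReal ε *
      (ENNReal.ofReal (|u x| ^ p x) + ENNReal.ofReal (|v x| ^ p x))) μ := (hu.add hv).const_mul _
  rw [← lintegral_add_left' hu, ← lintegral_const_mul' _ _ ENNReal.ofReal_ne_top,
    ← lintegral_const_mul' _ _ ENNReal.ofReal_ne_top, ← lintegral_add_left' huv]
  refine lintegral_mono_ae ?_
  filter_upwards [h, h', coeFn_signedPow p q u, coeFn_signedPow p q v] with x hx hx' h1 h2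
  rw [← ENNReal.ofReal_add (by positivity) (by positivity), ← ENNReal.ofReal_mul hε.le,
    ← ENNReal.ofReal_mul hC, ← ENNReal.ofReal_add (by positivity) (by positivity), h1, h2]
  exact ENNReal.ofReal_le_ofReal (hle _ _ _ _ hx hx')

theorem uniformContinuousOn_signedPow (p q : VarExponent μ) {R : ℝ} (hR : 0 < R) :
    UniformContinuousOn (signedPow p q) (Metric.ball 0 R) := by
  rw [Metric.uniformContinuousOn_iff]
  intro ε hε
  obtain ⟨δ, hδ, hd⟩ := exists_norm_le_of_modular_le q (half_pos hε)
  obtain ⟨M, hM, hMle⟩ := exists_modular_le_of_norm_lt p hR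
  -- With both modulars at most M on the ball, δ / (4M) makes the first term δ/2. The radius δ /
  -- (2(C + 1)) bounds the second by δ/2, and the cap 1 is needed because the norm bounds the
  -- modular only below one.
  obtain ⟨C, hC, hle⟩ := exists_modular_signedPow_sub_le p q
    (ε := δ / (4 * M)) (by positivity)
  refine ⟨min 1 (δ / (2 * (C + 1))), by positivity, fun u hu v hv huv => ?_⟩
  rw [mem_ball_zero_iff] at hu hv
  rw [dist_eq_norm] at huv ⊢
  have h1 : q.modular (signedPow p q u - signedPow p q v : VarLp q) ≤ ENNReal.ofReal δ := by
    refine (hle u v).trans ?_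
    calc _ ≤ ENNReal.ofReal (δ / (4 * M)) * (ENNReal.ofReal M + ENNReal.ofReal M) +
          ENNReal.ofReal C * ENNReal.ofReal (δ / (2 * (C + 1))) := by
          gcongr
          · exact hMle u hu
          · exact hMle v hv
          · exact (modular_le_of_norm_lt huv (min_le_left _ _)).trans
              (ENNReal.ofReal_le_ofReal (min_le_right _ _))
      _ = ENNReal.ofReal (δ / (4 * M) * (M + M) + C * (δ / (2 * (C + 1)))) := by
          rw [← ENNReal.ofReal_add hM.le hM.le, ← ENNReal.ofReal_mul (by positivity),
            ← ENNReal.ofReal_mul hC, ← ENNReal.ofReal_add (by positivity) (by positivity)]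
      _ ≤ _ := by
          refine ENNReal.ofReal_le_ofReal ?_
          have e1 : δ / (4 * M) * (M + M) = δ / 2 := by field_simp; ring
          have e2 : C * (δ / (2 * (C + 1))) ≤ δ / 2 := by
            rw [mul_div_assoc', div_le_div_iff₀ (by positivity) (by norm_num)]
            nlinarith
          linarith
  linarith [hd _ h1]

theorem continuous_signedPow (p q : VarExponent μ) : Continuous (signedPow p q) := by
  rw [continuous_iff_continuousAt]
  intro u
  have hR : 0 < ‖u‖ + 1 := by positivity
  exact (uniformContinuousOn_signedPow p q hR).continuousOn.continuousAt
    (Metric.isOpen_ball.mem_nhds (by simp))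

/-! ### Completeness and separability, transported from L². -/

/-- For exponent two the modular of u / k is the square of the L² norm of u / k, so the admissible k
are exactly the positive ones that are at least the L² norm. -/
theorem norm_two_eq (u : VarLp (VarExponent.two μ)) :
    ENNReal.ofReal ‖u‖ = eLpNorm u 2 μ := by
  have hmod : ∀ k : ℝ, 0 < k → ((VarExponent.two μ).modular (fun x => u x / k) ≤ 1 ↔
      eLpNorm u 2 μ ≤ ENNReal.ofReal k) := fun k hk => by
    have h1 : (VarExponent.two μ).modular (fun x => u x / k) =
        eLpNorm (fun x => u x / k) 2 μ ^ (2 : ℝ) := by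
      rw [eLpNorm_eq_lintegral_rpow_enorm_toReal (by norm_num) (by norm_num), ← ENNReal.rpow_mul]
      norm_num
      refine lintegral_congr fun x => ?_
      change ENNReal.ofReal (|u x / k| ^ (2 : ℝ)) = _
      rw [Real.enorm_eq_ofReal_abs, ← ENNReal.ofReal_pow (abs_nonneg _), Real.rpow_two]
    have h2 : (fun x => u x / k) = k⁻¹ • (u : α → ℝ) := by
      funext x; simp [div_eq_inv_mul]
    rw [h1, h2, eLpNorm_const_smul, Real.enorm_of_nonneg (by positivity)]
    have h4 : ∀ y : ℝ≥0∞, y ^ (2 : ℝ) ≤ 1 ↔ y ≤ 1 := fun y => by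
      rw [← ENNReal.rpow_le_rpow_iff (z := 2) (x := y) (by norm_num), ENNReal.one_rpow]
    rw [h4, ENNReal.ofReal_inv_of_pos hk, mul_comm,
      ← div_eq_mul_inv, ENNReal.div_le_iff (by simpa using hk) ENNReal.ofReal_ne_top, one_mul]
  refine le_antisymm ?_ ?_
  · refine ENNReal.le_of_forall_pos_le_add fun ε hε htop => ?_
    have hk : 0 < (eLpNorm u 2 μ).toReal + ε :=
      add_pos_of_nonneg_of_pos ENNReal.toReal_nonneg (by exact_mod_cast hε)
    have h3 : ENNReal.ofReal ((eLpNorm u 2 μ).toReal + ε) = eLpNorm u 2 μ + ε := by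
      rw [ENNReal.ofReal_add ENNReal.toReal_nonneg ε.coe_nonneg, ENNReal.ofReal_toReal htop.ne,
        ENNReal.ofReal_coe_nnreal]
    rw [← h3]
    refine ENNReal.ofReal_le_ofReal (csInf_le (lux_bddBelow u) ⟨hk, (hmod _ hk).2 ?_⟩)
    rw [h3]
    exact le_self_add
  · obtain ⟨k₀, hk₀⟩ := lux_nonempty u
    have htop : eLpNorm u 2 μ ≠ ∞ :=
      (((hmod _ hk₀.1).1 hk₀.2).trans_lt ENNReal.ofReal_lt_top).ne
    rw [← ENNReal.ofReal_toReal htop]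
    refine ENNReal.ofReal_le_ofReal (le_csInf (lux_nonempty u) fun k hk => ?_)
    exact ENNReal.toReal_le_of_le_ofReal hk.1.le ((hmod _ hk.1).1 hk.2)

theorem mem_two_iff (u : α →ₘ[μ] ℝ) : u ∈ VarLp (VarExponent.two μ) ↔ u ∈ Lp ℝ 2 μ := by
  rw [Lp.mem_Lp_iff_eLpNorm_lt_top]
  change (∫⁻ x, ENNReal.ofReal (|u x| ^ (2 : ℝ)) ∂μ) < ∞ ↔ _
  rw [eLpNorm_lt_top_iff_lintegral_rpow_enorm_lt_top (by norm_num) (by norm_num)]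
  simp only [Real.enorm_eq_ofReal_abs, ENNReal.toReal_ofNat]
  refine iff_of_eq (congrArg (· < ∞) (lintegral_congr fun x => ?_))
  rw [ENNReal.ofReal_rpow_of_nonneg (abs_nonneg _) (by norm_num)]

/-- The space with constant exponent two is the Hilbert space `L²`. -/
noncomputable def twoEquiv (μ : Measure α) : VarLp (VarExponent.two μ) ≃ₗᵢ[ℝ] Lp ℝ 2 μ where
  toFun u := ⟨u, (mem_two_iff _).1 u.2⟩
  invFun u := ⟨u, (mem_two_iff _).2 u.2⟩
  map_add' _ _ := rfl
  map_smul' _ _ := rfl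
  left_inv _ := rfl
  right_inv _ := rfl
  norm_map' u := by
    change (eLpNorm (u : α → ℝ) 2 μ).toReal = _
    rw [← norm_two_eq, ENNReal.toReal_ofReal (norm_nonneg u)]

/-- A Cauchy sequence lies in a ball, on which the signed power map to exponent two is uniformly
continuous, so its image is Cauchy. The continuous inverse map carries the limit back. -/
instance : CompleteSpace (VarLp p) := by
  have : CompleteSpace (VarLp (VarExponent.two μ)) :=
    (twoEquiv μ).toIsometryEquiv.completeSpace
  refine Metric.complete_of_cauchySeq_tendsto fun u hu => ?_
  obtain ⟨R, hR, hb⟩ := cauchySeq_bdd hu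
  have hball : ∀ n, u n ∈ Metric.ball (0 : VarLp p) (R + ‖u 0‖) := fun n => by
    rw [mem_ball_zero_iff]
    have h1 := hb n 0
    rw [dist_eq_norm] at h1
    linarith [norm_le_norm_sub_add (u n) (u 0)]
  have hS : CauchySeq fun n => signedPow p (VarExponent.two μ) (u n) := by
    have hR' : 0 < R + ‖u 0‖ := by positivity
    have huc := uniformContinuousOn_signedPow p (VarExponent.two μ) hR'
    rw [Metric.uniformContinuousOn_iff] at huc
    rw [Metric.cauchySeq_iff] at hu ⊢
    intro ε hε
    obtain ⟨δ, hδ, hd⟩ := huc ε hε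
    obtain ⟨n₀, hn⟩ := hu δ hδ
    exact ⟨n₀, fun m hm n hn' => hd _ (hball m) _ (hball n) (hn m hm n hn')⟩
  obtain ⟨g, hg⟩ := cauchySeq_tendsto_of_complete hS
  refine ⟨signedPow (VarExponent.two μ) p g, ?_⟩
  have := ((continuous_signedPow (VarExponent.two μ) p).tendsto g).comp hg
  simpa only [Function.comp_def, signedPow_signedPow] using this

instance [IsSeparable μ] : SecondCountableTopology (VarLp p) := by
  have : Fact ((2 : ℝ≥0∞) ≠ ∞) := ⟨by norm_num⟩
  have hs : TopologicalSpace.SeparableSpace (VarLp p) :=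
    Function.Surjective.denseRange
      (f := fun g : Lp ℝ 2 μ => signedPow (VarExponent.two μ) p ((twoEquiv μ).symm g))
      (fun u => ⟨twoEquiv μ (signedPow p _ u), by
        simp only [LinearIsometryEquiv.symm_apply_apply, signedPow_signedPow]⟩)
      |>.separableSpace
      ((continuous_signedPow _ _).comp (twoEquiv μ).symm.continuous)
  exact UniformSpace.secondCountable_of_separable _

end VarLp

/-! ### Duality pairing with the conjugate exponent. -/

/-- After scaling by λ this is Young's inequality for b times the signed power a^(q-1), since that
power raised to the conjugate exponent has absolute value |a|^q. -/
theorem rpow_gradient_le {lam q : ℝ} (hlam : 0 < lam) (hq : 1 < q) (r s : ℝ) :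
    lam / q * |r / lam| ^ q + spow (lam⁻¹ * r) (q - 1) * (s - r) ≤ lam / q * |s / lam| ^ q := by
  have hq0 : 0 < q := by linarith
  have hq1 : 0 < q - 1 := by linarith
  obtain ⟨a, rfl⟩ : ∃ a, r = lam * a := ⟨r / lam, by field_simp⟩
  obtain ⟨b, rfl⟩ : ∃ b, s = lam * b := ⟨s / lam, by field_simp⟩
  rw [inv_mul_cancel_left₀ hlam.ne', mul_div_cancel_left₀ _ hlam.ne',
    mul_div_cancel_left₀ _ hlam.ne']
  have h1 := Real.young_inequality b (spow a (q - 1)) (Real.HolderConjugate.conjExponent hq)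
  rw [abs_spow _ hq1.ne', ← Real.rpow_mul (abs_nonneg _), Real.conjExponent,
    mul_div_cancel₀ _ hq1.ne'] at h1
  have h2 := spow_mul_self a hq1
  rw [sub_add_cancel] at h2
  have h3 : |a| ^ q / (q / (q - 1)) = |a| ^ q - |a| ^ q / q := by field_simp
  have h4 : lam / q * |a| ^ q + spow a (q - 1) * (lam * b - lam * a) =
      lam * (|a| ^ q / q + b * spow a (q - 1) - spow a (q - 1) * a) := by ring
  rw [h4, h2]
  calc _ ≤ lam * (|b| ^ q / q) := by
        gcongr
        linarith
    _ = _ := by ring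

namespace VarExponent

variable {α : Type*} [MeasurableSpace α] {μ : Measure α}

theorem holderConjugate_conj (p : VarExponent μ) : ∀ᵐ x ∂μ, (p x).HolderConjugate (p.conj x) := by
  obtain ⟨a, b, ha, hab, h⟩ := p.bounds'
  filter_upwards [h] with x hx
  exact Real.HolderConjugate.conjExponent (by linarith [hx.1])

end VarExponent

namespace VarLp

variable {α : Type*} [MeasurableSpace α] {μ : Measure α} {p q : VarExponent μ}

theorem integrable_abs_rpow (u : VarLp p) : Integrable (fun x => |u x| ^ p x) μ := by
  have hm : AEMeasurable (fun x => |u x|) μ := by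
    simpa [Real.norm_eq_abs] using (aemeasurable u).norm
  refine ⟨(hm.pow p.aemeasurable').aestronglyMeasurable, ?_⟩
  rw [hasFiniteIntegral_iff_norm]
  refine lt_of_eq_of_lt (lintegral_congr fun x => ?_) (modular_lt_top u)
  rw [Real.norm_of_nonneg (by positivity)]

theorem integral_abs_rpow (u : VarLp p) : ∫ x, |u x| ^ p x ∂μ = (p.modular u).toReal := by
  rw [integral_eq_lintegral_of_nonneg_ae (Eventually.of_forall fun x => by positivity)
    (integrable_abs_rpow u).aestronglyMeasurable]
  rfl

theorem abs_mul_le_of_holderConjugate {p q : ℝ} (h : p.HolderConjugate q) (s t : ℝ) :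
    |s * t| ≤ |s| ^ p + |t| ^ q := by
  have h1 := Real.young_inequality |s| |t| h
  rw [abs_abs, abs_abs] at h1
  rw [abs_mul]
  refine h1.trans (add_le_add ?_ ?_)
  · exact div_le_self (by positivity) h.lt.le
  · exact div_le_self (by positivity) h.symm.lt.le

theorem integrable_mul (h : ∀ᵐ x ∂μ, (p x).HolderConjugate (q x)) (u : VarLp p) (v : VarLp q) :
    Integrable (fun x => u x * v x) μ := by
  refine ((integrable_abs_rpow u).add (integrable_abs_rpow v)).mono'
    ((aestronglyMeasurable u).mul (aestronglyMeasurable v)) ?_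
  filter_upwards [h] with x hx
  exact abs_mul_le_of_holderConjugate hx _ _

/-- Young's inequality for u / k and v, with k decreasing to ‖u‖. The constant is not sharp, but
linearity in ‖u‖ is all that continuity of the pairing requires. -/
theorem abs_integral_mul_le (h : ∀ᵐ x ∂μ, (p x).HolderConjugate (q x)) (u : VarLp p)
    (v : VarLp q) : |∫ x, u x * v x ∂μ| ≤ ((q.modular v).toReal + 1) * ‖u‖ := by
  have hM : 0 < (q.modular v).toReal + 1 := by positivity
  refine le_of_forall_pos_le_add fun ε hε => ?_
  set k : ℝ := ‖u‖ + ε / ((q.modular v).toReal + 1) with hk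
  have hk0 : 0 < k := by positivity
  have hlt : ‖u‖ < k := by
    rw [hk]
    have : 0 < ε / ((q.modular v).toReal + 1) := by positivity
    linarith
  have hmod : (p.modular (k⁻¹ • u : VarLp p)).toReal ≤ 1 := by
    rw [p.modular_congr (coeFn_smul k⁻¹ u)]
    exact ENNReal.toReal_mono ENNReal.one_ne_top (modular_le_one_of_norm_lt hlt)
  have h1 : |∫ x, u x * v x ∂μ| ≤
      ∫ x, k * (|(k⁻¹ • u : VarLp p) x| ^ p x + |v x| ^ q x) ∂μ := by
    rw [← Real.norm_eq_abs]
    refine norm_integral_le_of_norm_le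
      (((integrable_abs_rpow _).add (integrable_abs_rpow v)).const_mul k) ?_
    filter_upwards [h, coeFn_smul k⁻¹ u] with x hx hx'
    have h2 := abs_mul_le_of_holderConjugate hx (k⁻¹ * u x) (v x)
    rw [Real.norm_eq_abs]
    simp only [hx']
    calc |u x * v x| = k * |k⁻¹ * u x * v x| := by
          rw [mul_assoc, abs_mul k⁻¹, abs_of_pos (inv_pos.2 hk0)]
          field_simp
      _ ≤ _ := by gcongr
  rw [integral_const_mul, integral_add (integrable_abs_rpow _) (integrable_abs_rpow v),
    integral_abs_rpow, integral_abs_rpow] at h1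
  calc _ ≤ k * (1 + (q.modular v).toReal) := h1.trans (by gcongr)
    _ = _ := by
      rw [hk]
      field_simp
      ring

/-- The duality pairing `⟨ξ, v⟩ = ∫ ξ v dμ` as a continuous linear functional of `v`. -/
noncomputable def pairing (ξ : VarLp p.conj) : VarLp p →L[ℝ] ℝ :=
  LinearMap.mkContinuous
    { toFun := fun v => ∫ x, v x * ξ x ∂μ
      map_add' := fun u v => by
        rw [← integral_add (integrable_mul p.holderConjugate_conj u ξ)
          (integrable_mul p.holderConjugate_conj v ξ)]
        refine integral_congr_ae ?_
        filter_upwards [coeFn_add u v] with x hx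
        rw [hx, add_mul]
      map_smul' := fun c u => by
        rw [RingHom.id_apply, smul_eq_mul, ← integral_const_mul]
        refine integral_congr_ae ?_
        filter_upwards [coeFn_smul c u] with x hx
        rw [hx, mul_assoc] }
    ((p.conj.modular ξ).toReal + 1)
    fun v => abs_integral_mul_le p.holderConjugate_conj v ξ

theorem pairing_apply (ξ : VarLp p.conj) (v : VarLp p) : pairing ξ v = ∫ x, v x * ξ x ∂μ := rfl

theorem integral_mul_sub (ξ : VarLp p.conj) (u v : VarLp p) :
    ∫ x, ξ x * (v x - u x) ∂μ = pairing ξ (v - u) := by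
  rw [pairing_apply]
  refine integral_congr_ae ?_
  filter_upwards [coeFn_sub v u] with x hx
  rw [hx, mul_comm]

theorem pairing_sub (ξ η : VarLp p.conj) (v : VarLp p) :
    pairing (ξ - η) v = pairing ξ v - pairing η v := by
  rw [pairing_apply, pairing_apply, pairing_apply,
    ← integral_sub (integrable_mul p.holderConjugate_conj v ξ)
      (integrable_mul p.holderConjugate_conj v η)]
  refine integral_congr_ae ?_
  filter_upwards [coeFn_sub ξ η] with x hx
  rw [hx, mul_sub]

theorem pairing_neg (ξ : VarLp p.conj) (v : VarLp p) : pairing (-ξ) v = -pairing ξ v := by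
  have h := pairing_sub ξ ξ v
  have h' := pairing_sub (ξ - ξ) ξ v
  rw [sub_self, zero_sub] at h'
  rw [sub_self, sub_self] at h
  rw [h', h, zero_sub]

theorem continuous_pairing_left (v : VarLp p) : Continuous fun ξ : VarLp p.conj => pairing ξ v := by
  rw [continuous_iff_continuousAt]
  intro ξ
  rw [ContinuousAt, tendsto_iff_norm_sub_tendsto_zero]
  have hc : Tendsto (fun η : VarLp p.conj => ((p.modular v).toReal + 1) * ‖η - ξ‖) (𝓝 ξ)
      (𝓝 (((p.modular v).toReal + 1) * 0)) :=
    (tendsto_iff_norm_sub_tendsto_zero.1 tendsto_id).const_mul _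
  rw [mul_zero] at hc
  refine squeeze_zero (fun _ => norm_nonneg _) (fun η => ?_) hc
  rw [← pairing_sub, pairing_apply, Real.norm_eq_abs]
  simp_rw [mul_comm (v _)]
  exact abs_integral_mul_le (p.holderConjugate_conj.mono fun x hx => hx.symm) (η - ξ) v

/-- The difference is tested against its own signed power, which lies in L^{p(x)}. The pairing is
then the integral of a positive power of |ξ - η|. -/
theorem eq_of_pairing_eq {ξ η : VarLp p.conj} (h : ∀ v : VarLp p, pairing ξ v = pairing η v) :
    ξ = η := by
  have h0 : pairing (ξ - η) (signedPow p.conj p (ξ - η)) = 0 := by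
    rw [pairing_sub, h, sub_self]
  rw [pairing_apply] at h0
  obtain ⟨a, b, ha, hab, hp⟩ := p.bounds'
  obtain ⟨c, d, hc, hcd, hq⟩ := p.conj.bounds'
  have hae : (fun x => signedPow p.conj p (ξ - η) x * (ξ - η : VarLp p.conj) x) =ᵐ[μ]
      fun x => |(ξ - η : VarLp p.conj) x| ^ (p.conj x / p x + 1) := by
    filter_upwards [coeFn_signedPow p.conj p (ξ - η), hp, hq] with x hx hx1 hx2
    have h1 : 0 < p x := by linarith [hx1.1]
    have h2 : 0 < p.conj x := by linarith [hx2.1]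
    rw [hx, spow_mul_self _ (by positivity)]
  have hint :=
    (integrable_mul p.holderConjugate_conj (signedPow p.conj p (ξ - η)) (ξ - η)).congr hae
  rw [integral_congr_ae hae, integral_eq_zero_iff_of_nonneg (fun x => by positivity) hint] at h0
  refine ext_ae ?_
  filter_upwards [h0, coeFn_sub ξ η, hp, hq] with x hx hx' hx1 hx2
  have h1 : 0 < p x := by linarith [hx1.1]
  have h2 : 0 < p.conj x := by linarith [hx2.1]
  rw [Pi.zero_apply, Real.rpow_eq_zero (abs_nonneg _) (by positivity), abs_eq_zero, hx'] at hx
  exact sub_eq_zero.1 hx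

/-! ### The kinetic term: gradient and uniform convexity. -/

theorem aemeasurable_density (lam : ℝ) (p : VarExponent μ) {f : α → ℝ} (hf : AEMeasurable f μ) :
    AEMeasurable (fun x => lam / p x * |f x / lam| ^ p x) μ := by
  have hm : AEMeasurable (fun x => |f x / lam|) μ := by
    simpa only [Real.norm_eq_abs] using (hf.div_const lam).norm
  exact (aemeasurable_const.div p.aemeasurable').mul (hm.pow p.aemeasurable')

theorem integrable_density {lam : ℝ} (hlam : 0 < lam) (z : VarLp p) :
    Integrable (fun x => lam / p x * |z x / lam| ^ p x) μ := by
  obtain ⟨a, b, ha, hab, hp⟩ := p.bounds'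
  refine ((integrable_abs_rpow (lam⁻¹ • z)).const_mul lam).mono'
    (aemeasurable_density lam p (aemeasurable z)).aestronglyMeasurable ?_
  filter_upwards [hp, coeFn_smul lam⁻¹ z] with x hx hx'
  have h1 : 1 ≤ p x := by linarith [hx.1]
  rw [Real.norm_of_nonneg (by positivity), hx', div_eq_inv_mul (z x)]
  gcongr
  exact div_le_self hlam.le h1

/-- The kinetic term `∫ (λ / p(x)) |z(x) / λ|^{p(x)} dμ(x)`. -/
noncomputable def kinetic (lam : ℝ) (z : VarLp p) : ℝ :=
  ∫ x, lam / p x * |z x / lam| ^ p x ∂μ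

theorem density_nonneg {lam : ℝ} (hlam : 0 < lam) (f : α → ℝ) :
    0 ≤ᵐ[μ] fun x => lam / p x * |f x / lam| ^ p x := by
  obtain ⟨a, b, ha, hab, hp⟩ := p.bounds'
  filter_upwards [hp] with x hx
  have h1 : 0 < p x := by linarith [hx.1]
  change 0 ≤ lam / p x * |f x / lam| ^ p x
  positivity

theorem kinetic_nonneg {lam : ℝ} (hlam : 0 < lam) (z : VarLp p) : 0 ≤ kinetic lam z :=
  integral_nonneg_of_ae (density_nonneg hlam z)

theorem yosidaObjective_eq {lam : ℝ} (hlam : 0 < lam) (F : VarLp p → ℝ≥0∞) (u v : VarLp p) :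
    yosidaObjective lam F u v = ENNReal.ofReal (kinetic lam (v - u)) + F v := by
  rw [yosidaObjective, kinetic,
    ofReal_integral_eq_lintegral_ofReal (integrable_density hlam _) (density_nonneg hlam _)]
  congr 1
  refine lintegral_congr_ae ?_
  filter_upwards [coeFn_sub v u] with x hx
  rw [hx]

/-- The derivative of the kinetic term. -/
noncomputable def kineticGrad (lam : ℝ) (z : VarLp p) : VarLp p.conj :=
  signedPow p p.conj (lam⁻¹ • z)

/-- The exponent comes from p / p' = p - 1. -/
theorem coeFn_kineticGrad (lam : ℝ) (z : VarLp p) :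
    kineticGrad lam z =ᵐ[μ] fun x => spow (lam⁻¹ * z x) (p x - 1) := by
  obtain ⟨a, b, ha, hab, hp⟩ := p.bounds'
  filter_upwards [coeFn_signedPow p p.conj (lam⁻¹ • z), coeFn_smul lam⁻¹ z, hp] with x h1 h2 h3
  have h4 : 0 < p x := by linarith [h3.1]
  have h5 : 0 < p x - 1 := by linarith [h3.1]
  rw [kineticGrad, h1, h2]
  congr 1
  change p x / (p x / (p x - 1)) = _
  field_simp

theorem continuous_kineticGrad (lam : ℝ) :
    Continuous (kineticGrad lam : VarLp p → VarLp p.conj) :=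
  (continuous_signedPow p p.conj).comp (continuous_const_smul _)

theorem kinetic_gradient_le {lam : ℝ} (hlam : 0 < lam) (z y : VarLp p) :
    kinetic lam z + pairing (kineticGrad lam z) (y - z) ≤ kinetic lam y := by
  obtain ⟨a, b, ha, hab, hp⟩ := p.bounds'
  rw [pairing_apply, kinetic, kinetic, ← integral_add (integrable_density hlam z)
    (integrable_mul p.holderConjugate_conj _ _)]
  refine integral_mono_ae ((integrable_density hlam z).add
    (integrable_mul p.holderConjugate_conj _ _)) (integrable_density hlam y) ?_
  filter_upwards [coeFn_kineticGrad lam z, coeFn_sub y z, hp] with x h1 h2 h3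
  have := rpow_gradient_le hlam (show 1 < p x by linarith [h3.1]) (z x) (y x)
  simp only [h1, h2]
  rw [mul_comm (y x - z x)]
  exact this

/-- Uniform convexity of the kinetic term. -/
theorem exists_modular_sub_le {lam : ℝ} (hlam : 0 < lam) (p : VarExponent μ) {ε : ℝ} (hε : 0 < ε) :
    ∃ C : ℝ, 0 ≤ C ∧ ∀ z y : VarLp p, p.modular (z - y : VarLp p) ≤ ENNReal.ofReal
      (ε * (kinetic lam z + kinetic lam y) +
        C * ((kinetic lam z + kinetic lam y) / 2 - kinetic lam ((1 / 2 : ℝ) • (z + y)))) := by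
  obtain ⟨a, b, ha, hab, hp⟩ := p.bounds'
  obtain ⟨D, hD, hDle⟩ := p.exists_modular_mul_le lam
  have hb : 0 < b := by linarith
  -- D pays for pulling the factor λ out of z - y, and b / λ for the bound λ / p ≥ λ / b on the
  -- weight of the density.
  set ε' := ε * lam / (D * b) with hε'
  have hε0 : 0 < ε' := by positivity
  obtain ⟨C, hC, hle⟩ := abs_sub_rpow_le (b := b) ha hε0
  refine ⟨D * (C * b / lam), by positivity, fun z y => ?_⟩
  have hmid : (z - y : VarLp p) =ᵐ[μ] fun x => lam * (lam⁻¹ • (z - y) : VarLp p) x := by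
    filter_upwards [coeFn_smul lam⁻¹ (z - y)] with x hx
    rw [hx, mul_inv_cancel_left₀ hlam.ne']
  rw [p.modular_congr hmid]
  refine (hDle _).trans ?_
  rw [← ENNReal.ofReal_toReal (modular_lt_top (lam⁻¹ • (z - y))).ne, ← ENNReal.ofReal_mul hD.le]
  refine ENNReal.ofReal_le_ofReal ?_
  have hz := integrable_density hlam z
  have hy := integrable_density hlam y
  have hm := integrable_density hlam ((1 / 2 : ℝ) • (z + y))
  have key : (p.modular (lam⁻¹ • (z - y) : VarLp p)).toReal ≤
      ε' * b / lam * (kinetic lam z + kinetic lam y) + C * b / lam *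
        ((kinetic lam z + kinetic lam y) / 2 - kinetic lam ((1 / 2 : ℝ) • (z + y))) := by
    have hadd : Integrable (fun x => lam / p x * |z x / lam| ^ p x +
        lam / p x * |y x / lam| ^ p x) μ := hz.add hy
    have hhalf : Integrable (fun x => (lam / p x * |z x / lam| ^ p x +
        lam / p x * |y x / lam| ^ p x) / 2) μ := hadd.div_const 2
    have hdef : Integrable (fun x => (lam / p x * |z x / lam| ^ p x +
        lam / p x * |y x / lam| ^ p x) / 2 -
        lam / p x * |((1 / 2 : ℝ) • (z + y) : VarLp p) x / lam| ^ p x) μ := hhalf.sub hm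
    rw [← integral_abs_rpow, kinetic, kinetic, kinetic, ← integral_add hz hy,
      ← integral_div, ← integral_const_mul, ← integral_sub hhalf hm,
      ← integral_const_mul, ← integral_add (hadd.const_mul _) (hdef.const_mul _)]
    refine integral_mono_ae (integrable_abs_rpow _)
      ((hadd.const_mul _).add (hdef.const_mul _)) ?_
    filter_upwards [hp, coeFn_smul lam⁻¹ (z - y), coeFn_sub z y, coeFn_add z y,
      coeFn_smul (1 / 2 : ℝ) (z + y)] with x hx h1 h2 h3 h4
    have hp0 : 0 < p x := by linarith [hx.1]
    have h5 := hle (z x / lam) (y x / lam) (p x) hx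
    have h6 := abs_midpoint_rpow_le (show 1 < p x by linarith [hx.1]) (z x / lam) (y x / lam)
    have e1 : lam⁻¹ * (z x - y x) = z x / lam - y x / lam := by ring
    have e2 : 1 / 2 * (z x + y x) / lam = (z x / lam + y x / lam) / 2 := by ring
    simp only [h1, h2, h3, h4, e1, e2]
    refine h5.trans ?_
    set A := |z x / lam| ^ p x
    set B := |y x / lam| ^ p x
    set M := |(z x / lam + y x / lam) / 2| ^ p x
    have hA : 0 ≤ A := by positivity
    have hB : 0 ≤ B := by positivity
    have h7 : 1 ≤ b / p x := (one_le_div hp0).2 hx.2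
    have e3 : ε' * b / lam * (lam / p x * A + lam / p x * B) + C * b / lam *
        ((lam / p x * A + lam / p x * B) / 2 - lam / p x * M) =
        b / p x * (ε' * (A + B) + C * ((A + B) / 2 - M)) := by
      field_simp
    rw [e3]
    refine le_mul_of_one_le_left ?_ h7
    have : 0 ≤ (A + B) / 2 - M := by linarith
    positivity
  calc _ ≤ D * (ε' * b / lam * (kinetic lam z + kinetic lam y) + C * b / lam *
        ((kinetic lam z + kinetic lam y) / 2 - kinetic lam ((1 / 2 : ℝ) • (z + y)))) := by gcongr
    _ = _ := by
      rw [hε']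
      field_simp

end VarLp

/-! ### Existence of minimizers. -/

theorem ConvexOn.ennreal_le {E : Type*} [AddCommGroup E] [Module ℝ E] {F : E → ℝ≥0∞}
    (hF : ConvexOn ℝ≥0 univ F) {s t : ℝ} (hs : 0 ≤ s) (ht : 0 ≤ t) (hst : s + t = 1) (u v : E) :
    F (s • u + t • v) ≤ ENNReal.ofReal s * F u + ENNReal.ofReal t * F v := by
  have h := hF.2 (mem_univ u) (mem_univ v) (zero_le (a := s.toNNReal))
    (zero_le (a := t.toNNReal)) (by rw [← Real.toNNReal_add hs ht, hst, Real.toNNReal_one])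
  rwa [NNReal.smul_def, NNReal.smul_def, Real.coe_toNNReal _ hs, Real.coe_toNNReal _ ht] at h

namespace VarLp

variable {α : Type*} [MeasurableSpace α] {μ : Measure α} {p : VarExponent μ}
  {lam : ℝ} {F : VarLp p → ℝ≥0∞}

theorem moreauYosida_le (lam : ℝ) (F : VarLp p → ℝ≥0∞) (w v : VarLp p) :
    moreauYosida lam F w ≤ yosidaObjective lam F w v := iInf_le _ v

theorem moreauYosida_ne_top (hlam : 0 < lam) (hproper : ∃ v, F v ≠ ∞) (w : VarLp p) :
    moreauYosida lam F w ≠ ∞ := by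
  obtain ⟨v, hv⟩ := hproper
  refine ((moreauYosida_le lam F w v).trans_lt ?_).ne
  rw [yosidaObjective_eq hlam]
  exact ENNReal.add_lt_top.2 ⟨ENNReal.ofReal_lt_top, hv.lt_top⟩

theorem toReal_moreauYosida_le (hlam : 0 < lam) (w : VarLp p) {v : VarLp p} (hv : F v ≠ ∞) :
    (moreauYosida lam F w).toReal ≤ kinetic lam (v - w) + (F v).toReal := by
  have h := moreauYosida_le lam F w v
  rw [yosidaObjective_eq hlam] at h
  have h' := ENNReal.toReal_mono (ENNReal.add_ne_top.2 ⟨ENNReal.ofReal_ne_top, hv⟩) h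
  rwa [ENNReal.toReal_add ENNReal.ofReal_ne_top hv,
    ENNReal.toReal_ofReal (kinetic_nonneg hlam _)] at h'

/-- Along a minimizing sequence of the objective of the regularization, the modular of the
differences tends to zero, by uniform convexity. -/
theorem exists_moreauYosida_eq (hlam : 0 < lam) (hF : ConvexOn ℝ≥0 univ F)
    (hlsc : LowerSemicontinuous F) (hproper : ∃ v, F v ≠ ∞) (w : VarLp p) :
    ∃ v, moreauYosida lam F w = yosidaObjective lam F w v := by
  have hm := moreauYosida_ne_top hlam hproper w
  set M := (moreauYosida lam F w).toReal with hMdef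
  have hM : moreauYosida lam F w = ENNReal.ofReal M := (ENNReal.ofReal_toReal hm).symm
  have hM0 : 0 ≤ M := ENNReal.toReal_nonneg
  have hseq : ∀ n : ℕ, ∃ v, F v ≠ ∞ ∧ kinetic lam (v - w) + (F v).toReal < M + 1 / (n + 1) := by
    intro n
    have hlt : moreauYosida lam F w < ENNReal.ofReal (M + 1 / (n + 1)) := by
      rw [hM]
      have h0 : (0 : ℝ) < 1 / (n + 1) := by positivity
      exact (ENNReal.ofReal_lt_ofReal_iff (by positivity)).2 (by linarith)
    obtain ⟨v, hv⟩ := iInf_lt_iff.1 hlt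
    rw [yosidaObjective_eq hlam] at hv
    have hFv : F v ≠ ∞ := (lt_of_le_of_lt le_add_self (hv.trans ENNReal.ofReal_lt_top)).ne
    refine ⟨v, hFv, ?_⟩
    rw [← ENNReal.ofReal_toReal hFv, ← ENNReal.ofReal_add (kinetic_nonneg hlam _)
      ENNReal.toReal_nonneg] at hv
    exact ((ENNReal.ofReal_lt_ofReal_iff (by positivity)).1 hv)
  choose v hv hvle using hseq
  have hcauchy : CauchySeq v := by
    refine cauchySeq_of_modular fun δ hδ => ?_
    -- The two kinetic terms add up to at most 2(M + 1), so this choice makes the first error δ/2.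
    -- The bound N > 2C / δ does the same for C / (N + 1).
    obtain ⟨C, hC, hunif⟩ := exists_modular_sub_le hlam p (ε := δ / (4 * (M + 1))) (by positivity)
    obtain ⟨N, hN⟩ := exists_nat_gt (2 * C / δ)
    refine ⟨N, fun m hm n hn => ?_⟩
    have hpos : (0 : ℝ) < N + 1 := by positivity
    have hbound : ∀ k ≥ N, kinetic lam (v k - w) + (F (v k)).toReal < M + 1 / (N + 1) :=
      fun k hk => (hvle k).trans_le (by
        have : (N : ℝ) ≤ k := by exact_mod_cast hk
        gcongr)
    have hone : (1 : ℝ) / (N + 1) ≤ 1 := by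
      rw [div_le_one hpos]
      linarith [(Nat.cast_nonneg N : (0 : ℝ) ≤ N)]
    have h1 := hunif (v m - w) (v n - w)
    rw [sub_sub_sub_cancel_right, modular_sub_eq] at h1
    refine h1.trans (ENNReal.ofReal_le_ofReal ?_)
    set mid : VarLp p := (1 / 2 : ℝ) • v m + (1 / 2 : ℝ) • v n with hmid
    have emid : (1 / 2 : ℝ) • (v m - w + (v n - w)) = mid - w := by
      rw [hmid]
      module
    rw [emid]
    have hcv := hF.ennreal_le (s := 1 / 2) (t := 1 / 2) (by norm_num) (by norm_num) (by norm_num)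
      (v m) (v n)
    rw [← hmid] at hcv
    have hfin : ENNReal.ofReal (1 / 2) * F (v m) + ENNReal.ofReal (1 / 2) * F (v n) ≠ ∞ :=
      ENNReal.add_ne_top.2 ⟨ENNReal.mul_ne_top ENNReal.ofReal_ne_top (hv m),
        ENNReal.mul_ne_top ENNReal.ofReal_ne_top (hv n)⟩
    have hFmid : F mid ≠ ∞ := (hcv.trans_lt hfin.lt_top).ne
    have hcv' := ENNReal.toReal_mono hfin hcv
    rw [ENNReal.toReal_add (ENNReal.mul_ne_top ENNReal.ofReal_ne_top (hv m))
      (ENNReal.mul_ne_top ENNReal.ofReal_ne_top (hv n)), ENNReal.toReal_mul, ENNReal.toReal_mul,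
      ENNReal.toReal_ofReal (by norm_num)] at hcv'
    have h2 := toReal_moreauYosida_le hlam w hFmid
    have h3 := hbound m hm
    have h4 := hbound n hn
    have h5 : 0 ≤ (F (v m)).toReal := ENNReal.toReal_nonneg
    have h6 : 0 ≤ (F (v n)).toReal := ENNReal.toReal_nonneg
    set a := kinetic lam (v m - w)
    set b := kinetic lam (v n - w)
    set c := kinetic lam (mid - w)
    -- The midpoint is a competitor, so c + F(mid) ≥ M. By convexity F(mid) is at most the mean of
    -- the two values of F, and both objectives lie below M + 1/(N + 1).
    have h7 : (a + b) / 2 - c ≤ 1 / (N + 1) := by linarith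
    have h8 : C * (1 / (N + 1)) ≤ δ / 2 := by
      rw [mul_one_div, div_le_iff₀ hpos]
      rw [div_lt_iff₀ hδ] at hN
      nlinarith
    calc _ ≤ δ / (4 * (M + 1)) * (2 * (M + 1)) + C * (1 / (N + 1)) := by
          gcongr
          linarith
      _ ≤ δ / 2 + δ / 2 := by
          gcongr
          refine le_of_eq ?_
          field_simp
          norm_num
      _ = δ := by ring
  obtain ⟨v₀, hv₀⟩ := cauchySeq_tendsto_of_complete hcauchy
  refine ⟨v₀, le_antisymm (moreauYosida_le _ _ _ _) ?_⟩
  -- The subgradient inequality at the limit bounds the kinetic terms of v n from below, hence F (v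
  -- n) from above. Lower semicontinuity of F then suffices for v₀.
  have hr : Tendsto (fun n : ℕ => M + 1 / ((n : ℝ) + 1) - kinetic lam (v₀ - w) -
      pairing (kineticGrad lam (v₀ - w)) (v n - v₀)) atTop (𝓝 (M - kinetic lam (v₀ - w))) := by
    have h1 : Tendsto (fun n => pairing (kineticGrad lam (v₀ - w)) (v n - v₀)) atTop (𝓝 0) := by
      have h2 := ((pairing (kineticGrad lam (v₀ - w))).continuous.tendsto (v₀ - v₀)).comp
        (hv₀.sub_const v₀)
      rwa [sub_self, map_zero] at h2
    have h3 := (((tendsto_one_div_add_atTop_nhds_zero_nat (𝕜 := ℝ)).const_add M).sub_const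
      (kinetic lam (v₀ - w))).sub h1
    simpa using h3
  have hFr : ∀ n, (F (v n)).toReal ≤ M + 1 / ((n : ℝ) + 1) - kinetic lam (v₀ - w) -
      pairing (kineticGrad lam (v₀ - w)) (v n - v₀) := fun n => by
    have h1 := kinetic_gradient_le hlam (v₀ - w) (v n - w)
    rw [sub_sub_sub_cancel_right] at h1
    linarith [hvle n]
  have hnonneg : 0 ≤ M - kinetic lam (v₀ - w) :=
    ge_of_tendsto' hr fun n => ENNReal.toReal_nonneg.trans (hFr n)
  have hFv : F v₀ ≤ ENNReal.ofReal (M - kinetic lam (v₀ - w)) := by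
    by_contra! hlt
    obtain ⟨y, hy1, hy2⟩ := exists_between hlt
    have h1 := hv₀.eventually (hlsc v₀ y hy2)
    have h2 := (ENNReal.continuous_ofReal.tendsto _).comp hr |>.eventually (gt_mem_nhds hy1)
    obtain ⟨n, hn1, hn2⟩ := (h1.and h2).exists
    rw [← ENNReal.ofReal_toReal (hv n)] at hn1
    exact absurd (hn1.trans_le (ENNReal.ofReal_le_ofReal (hFr n))) (not_lt.2 hn2.le)
  rw [yosidaObjective_eq hlam, hM]
  calc _ ≤ ENNReal.ofReal (kinetic lam (v₀ - w)) + ENNReal.ofReal (M - kinetic lam (v₀ - w)) := by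
        gcongr
    _ = ENNReal.ofReal M := by
      rw [← ENNReal.ofReal_add (kinetic_nonneg hlam _) hnonneg]
      congr 1
      ring

/-! ### Euler-Lagrange inclusion and the subdifferential of the regularization. -/

theorem mem_subdiff_iff {u : VarLp p} {ξ : VarLp p.conj} : ξ ∈ subdiff F u ↔
    F u ≠ ∞ ∧ ∀ v, F v ≠ ∞ → pairing ξ (v - u) ≤ (F v).toReal - (F u).toReal := by
  simp only [subdiff, mem_ofPred_eq, integral_mul_sub]

/-- The values of a minimizer are finite. -/
theorem ne_top_of_moreauYosida_eq (hlam : 0 < lam) (hproper : ∃ v, F v ≠ ∞) {w v : VarLp p}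
    (h : moreauYosida lam F w = yosidaObjective lam F w v) : F v ≠ ∞ := by
  have h1 := moreauYosida_ne_top hlam hproper w
  rw [h, yosidaObjective_eq hlam] at h1
  exact (ENNReal.add_ne_top.1 h1).2

theorem toReal_moreauYosida_eq (hlam : 0 < lam) {w v : VarLp p} (hv : F v ≠ ∞)
    (h : moreauYosida lam F w = yosidaObjective lam F w v) :
    (moreauYosida lam F w).toReal = kinetic lam (v - w) + (F v).toReal := by
  rw [h, yosidaObjective_eq hlam, ENNReal.toReal_add ENNReal.ofReal_ne_top hv,
    ENNReal.toReal_ofReal (kinetic_nonneg hlam _)]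

/-- This stands in for differentiability of the kinetic term: the gradient inequality is used at a
perturbed point, divided by s, and the gradient is moved back as s tends to zero. -/
theorem tendsto_pairing_kineticGrad (lam : ℝ) (z h k : VarLp p) :
    Tendsto (fun s : ℝ => pairing (kineticGrad lam (z + s • h)) k) (𝓝[>] 0)
      (𝓝 (pairing (kineticGrad lam z) k)) := by
  have hc : Continuous fun s : ℝ => pairing (kineticGrad lam (z + s • h)) k :=
    (continuous_pairing_left k).comp ((continuous_kineticGrad lam).comp (by fun_prop))
  have h0 := hc.tendsto 0
  rw [zero_smul, add_zero] at h0
  exact h0.mono_left nhdsWithin_le_nhds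

/-- The Euler-Lagrange inclusion of a minimizer. -/
theorem neg_kineticGrad_mem_subdiff (hlam : 0 < lam) (hF : ConvexOn ℝ≥0 univ F)
    (hproper : ∃ v, F v ≠ ∞) {w v₀ : VarLp p}
    (hmin : moreauYosida lam F w = yosidaObjective lam F w v₀) :
    -kineticGrad lam (v₀ - w) ∈ subdiff F v₀ := by
  have hv₀ := ne_top_of_moreauYosida_eq hlam hproper hmin
  rw [mem_subdiff_iff]
  refine ⟨hv₀, fun v hv => ?_⟩
  rw [pairing_neg]
  have hlim := (tendsto_pairing_kineticGrad lam (v₀ - w) (v - v₀) (v - v₀)).neg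
  refine le_of_tendsto hlim ?_
  filter_upwards [Ioc_mem_nhdsGT (zero_lt_one (α := ℝ))] with s hs
  have hs1 : 0 ≤ 1 - s := by linarith [hs.2]
  set y : VarLp p := (1 - s) • v₀ + s • v with hy
  have hcv := hF.ennreal_le hs1 hs.1.le (by ring) v₀ v
  have hfin1 := ENNReal.mul_ne_top (ENNReal.ofReal_ne_top (r := 1 - s)) hv₀
  have hfin2 := ENNReal.mul_ne_top (ENNReal.ofReal_ne_top (r := s)) hv
  have hFy : F y ≠ ∞ := (hcv.trans_lt (ENNReal.add_ne_top.2 ⟨hfin1, hfin2⟩).lt_top).ne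
  have hcv' := ENNReal.toReal_mono (ENNReal.add_ne_top.2 ⟨hfin1, hfin2⟩) hcv
  rw [ENNReal.toReal_add hfin1 hfin2, ENNReal.toReal_mul, ENNReal.toReal_mul,
    ENNReal.toReal_ofReal hs1, ENNReal.toReal_ofReal hs.1.le, ← hy] at hcv'
  have h1 := toReal_moreauYosida_le hlam w hFy
  rw [toReal_moreauYosida_eq hlam hv₀ hmin] at h1
  -- The gradient is taken at the perturbed point y - w, so that convexity bounds the kinetic
  -- increment from above.
  have h2 := kinetic_gradient_le hlam (y - w) (v₀ - w)
  rw [show v₀ - w - (y - w) = -(s • (v - v₀)) by rw [hy]; module,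
    show y - w = v₀ - w + s • (v - v₀) by rw [hy]; module, map_neg, map_smul, smul_eq_mul] at h2
  rw [show y - w = v₀ - w + s • (v - v₀) by rw [hy]; module] at h1
  have h3 : s * (-pairing (kineticGrad lam (v₀ - w + s • (v - v₀))) (v - v₀)) ≤
      s * ((F v).toReal - (F v₀).toReal) := by linarith
  exact le_of_mul_le_mul_left h3 hs.1

/-- Adding the subgradient inequalities of F and of the kinetic term cancels the pairings. Through
this converse, a pointwise inclusion becomes pointwise minimality. -/
theorem moreauYosida_eq_of_mem_subdiff (hlam : 0 < lam) {w v₀ : VarLp p}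
    (h : -kineticGrad lam (v₀ - w) ∈ subdiff F v₀) :
    moreauYosida lam F w = yosidaObjective lam F w v₀ := by
  rw [mem_subdiff_iff] at h
  refine le_antisymm (moreauYosida_le _ _ _ _) (le_iInf fun v => ?_)
  rw [yosidaObjective_eq hlam, yosidaObjective_eq hlam]
  rcases eq_or_ne (F v) ∞ with hv | hv
  · rw [hv, add_top]
    exact le_top
  · have h1 := h.2 v hv
    rw [pairing_neg] at h1
    have h2 := kinetic_gradient_le hlam (v₀ - w) (v - w)
    rw [sub_sub_sub_cancel_right] at h2
    rw [← ENNReal.ofReal_toReal hv, ← ENNReal.ofReal_toReal h.1,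
      ← ENNReal.ofReal_add (kinetic_nonneg hlam _) ENNReal.toReal_nonneg,
      ← ENNReal.ofReal_add (kinetic_nonneg hlam _) ENNReal.toReal_nonneg]
    exact ENNReal.ofReal_le_ofReal (by linarith)

/-- Membership: the subgradient inequalities of F at v₀ and of the kinetic term at v₀ - w are added,
with a minimizer v' at w'. Uniqueness: keeping v₀ as competitor at w + s h bounds the regularization
above by a function that touches it at w and has slope -G(v₀ - w), so a subgradient is at most -G(v₀
- w) in the directions h and -h. -/
theorem subdiff_moreauYosida_eq (hlam : 0 < lam) (hF : ConvexOn ℝ≥0 univ F)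
    (hlsc : LowerSemicontinuous F) (hproper : ∃ v, F v ≠ ∞) {w v₀ : VarLp p}
    (hmin : moreauYosida lam F w = yosidaObjective lam F w v₀) :
    subdiff (moreauYosida lam F) w = {-kineticGrad lam (v₀ - w)} := by
  have hv₀ := ne_top_of_moreauYosida_eq hlam hproper hmin
  refine eq_singleton_iff_unique_mem.2 ⟨?_, fun ξ hξ => ?_⟩
  · have hsub := (mem_subdiff_iff.1 (neg_kineticGrad_mem_subdiff hlam hF hproper hmin)).2
    refine mem_subdiff_iff.2 ⟨moreauYosida_ne_top hlam hproper w, fun w' _ => ?_⟩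
    obtain ⟨v', hv'⟩ := exists_moreauYosida_eq hlam hF hlsc hproper w'
    have hFv' := ne_top_of_moreauYosida_eq hlam hproper hv'
    have h1 := hsub v' hFv'
    have h2 := kinetic_gradient_le hlam (v₀ - w) (v' - w')
    rw [toReal_moreauYosida_eq hlam hv₀ hmin, toReal_moreauYosida_eq hlam hFv' hv']
    rw [show v' - w' - (v₀ - w) = (v' - v₀) - (w' - w) by abel, map_sub] at h2
    rw [pairing_neg] at h1 ⊢
    linarith
  · rw [mem_subdiff_iff] at hξ
    have hle : ∀ h, pairing ξ h ≤ -pairing (kineticGrad lam (v₀ - w)) h := fun h => by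
      have hlim := (tendsto_pairing_kineticGrad lam (v₀ - w) (-h) h).neg
      refine ge_of_tendsto hlim ?_
      filter_upwards [self_mem_nhdsWithin] with s hs
      have hs' : 0 < s := hs
      have h1 := hξ.2 (w + s • h) (moreauYosida_ne_top hlam hproper _)
      have h2 := toReal_moreauYosida_le hlam (w + s • h) hv₀
      have h3 := kinetic_gradient_le hlam (v₀ - w + s • -h) (v₀ - w)
      rw [toReal_moreauYosida_eq hlam hv₀ hmin, add_sub_cancel_left, map_smul, smul_eq_mul] at h1
      rw [show v₀ - (w + s • h) = v₀ - w + s • -h by module] at h2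
      rw [show v₀ - w - (v₀ - w + s • -h) = s • h by module, map_smul, smul_eq_mul] at h3
      have h4 : s * pairing ξ h ≤ s * -pairing (kineticGrad lam (v₀ - w + s • -h)) h := by
        linarith
      exact le_of_mul_le_mul_left h4 hs'
    refine eq_of_pairing_eq fun h => ?_
    have h1 := hle h
    have h2 := hle (-h)
    rw [map_neg, map_neg] at h2
    rw [pairing_neg]
    linarith

/-- The dense set is chosen in the graph of φ, not merely in its domain: φ is not assumed
continuous, so approximating points must bring their values along. The tested inequality is closed
in (w, φ w). -/
theorem exists_countable_subdiff_test [SecondCountableTopology (VarLp p)] (φ : VarLp p → ℝ≥0∞) :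
    ∃ D : Set (VarLp p), D.Countable ∧ (∀ w ∈ D, φ w ≠ ∞) ∧ ∀ (η : VarLp p.conj) (v : VarLp p),
      φ v ≠ ∞ → (∀ w ∈ D, pairing η (w - v) ≤ (φ w).toReal - (φ v).toReal) →
        η ∈ subdiff φ v := by
  let G : Set (VarLp p × ℝ) := (fun w => (w, (φ w).toReal)) '' {w | φ w ≠ ∞}
  obtain ⟨C, hCG, hCc, hdense⟩ :=
    (TopologicalSpace.IsSeparable.of_separableSpace G).exists_countable_dense_subset
  refine ⟨Prod.fst '' C, hCc.image _, ?_, fun η v hv h => mem_subdiff_iff.2 ⟨hv, fun w hw => ?_⟩⟩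
  · rintro _ ⟨c, hc, rfl⟩
    obtain ⟨w, hw, rfl⟩ := hCG hc
    exact hw
  · have hclosed : IsClosed {c : VarLp p × ℝ | pairing η (c.1 - v) ≤ c.2 - (φ v).toReal} :=
      isClosed_le (by fun_prop) (by fun_prop)
    have hsub : C ⊆ {c : VarLp p × ℝ | pairing η (c.1 - v) ≤ c.2 - (φ v).toReal} := by
      intro c hc
      have h1 := h c.1 ⟨c, hc, rfl⟩
      obtain ⟨w, _, rfl⟩ := hCG hc
      exact h1
    exact closure_minimal hsub hclosed (hdense ⟨w, hw, rfl⟩)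

end VarLp

/-! ### Slices in time and their measurability. -/

section TimeSlices

open VarLp

variable {α τ : Type*} [MeasurableSpace α] [MeasurableSpace τ] {μ : Measure α} {ν : Measure τ}
  [SFinite μ] [SFinite ν] {p : VarExponent μ}

theorem ae_ae_of_ae_prod_symm {P : α × τ → Prop} (h : ∀ᵐ z ∂μ.prod ν, P z) :
    ∀ᵐ t ∂ν, ∀ᵐ x ∂μ, P (x, t) := by
  have h' : ∀ᵐ z ∂ν.prod μ, P z.swap :=
    (Measure.measurePreserving_swap (μ := ν) (ν := μ)).quasiMeasurePreserving.ae h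
  exact Measure.ae_ae_of_ae_prod h'

theorem evalP_ae_eq {u : VarLp (p.ext ν)} {f : α × τ → ℝ} (h : (u : α × τ → ℝ) =ᵐ[μ.prod ν] f) :
    ∀ᵐ t ∂ν, (evalP p u t : α → ℝ) =ᵐ[μ] fun x => f (x, t) := by
  filter_upwards [evalP_coeFn p u, ae_ae_of_ae_prod_symm h] with t h1 h2
  exact h1.trans h2

theorem aemeasurable_modular_slice (p : VarExponent μ) {f : α × τ → ℝ}
    (hf : AEMeasurable f (μ.prod ν)) : AEMeasurable (fun t => p.modular fun x => f (x, t)) ν :=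
  ((p.ext ν).aemeasurable_pow hf).lintegral_prod_left'

theorem modular_ext_eq (p : VarExponent μ) {f : α × τ → ℝ} (hf : AEMeasurable f (μ.prod ν)) :
    (p.ext ν).modular f = ∫⁻ t, p.modular (fun x => f (x, t)) ∂ν :=
  lintegral_prod_symm _ ((p.ext ν).aemeasurable_pow hf)

theorem evalP_sub (u v : VarLp (p.ext ν)) :
    ∀ᵐ t ∂ν, evalP p (u - v) t = evalP p u t - evalP p v t := by
  filter_upwards [evalP_ae_eq (coeFn_sub u v), evalP_coeFn p u, evalP_coeFn p v] with t h1 h2 h3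
  refine ext_ae ?_
  filter_upwards [h1, h2, h3, coeFn_sub (evalP p u t) (evalP p v t)] with x g1 g2 g3 g4
  rw [g1, g4, g2, g3]

theorem evalP_smul_add_smul (a b : ℝ) (u v : VarLp (p.ext ν)) :
    ∀ᵐ t ∂ν, evalP p (a • u + b • v) t = a • evalP p u t + b • evalP p v t := by
  filter_upwards [evalP_ae_eq (coeFn_add (a • u) (b • v)),
    ae_ae_of_ae_prod_symm (coeFn_smul a u), ae_ae_of_ae_prod_symm (coeFn_smul b v),
    evalP_coeFn p u, evalP_coeFn p v] with t h1 h2 h3 h4 h5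
  refine ext_ae ?_
  filter_upwards [h1, h2, h3, h4, h5, coeFn_add (a • evalP p u t) (b • evalP p v t),
    coeFn_smul a (evalP p u t), coeFn_smul b (evalP p v t)] with x g1 g2 g3 g4 g5 g6 g7 g8
  rw [g1, g2, g3, g6, g7, g8, g4, g5]

theorem evalP_neg_kineticGrad (lam : ℝ) (u v : VarLp (p.ext ν)) :
    ∀ᵐ t ∂ν, evalP p.conj (-kineticGrad lam (v - u) : VarLp (p.ext ν).conj) t =
      -kineticGrad lam (evalP p v t - evalP p u t) := by
  have h1 := coeFn_smul (-1) (kineticGrad lam (v - u))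
  rw [neg_one_smul] at h1
  filter_upwards [evalP_ae_eq (p := p.conj) h1,
    ae_ae_of_ae_prod_symm (coeFn_kineticGrad lam (v - u)), ae_ae_of_ae_prod_symm (coeFn_sub v u),
    evalP_coeFn p u, evalP_coeFn p v] with t h1 h2 h3 h4 h5
  have h6 := coeFn_smul (-1) (kineticGrad lam (evalP p v t - evalP p u t))
  rw [neg_one_smul] at h6
  refine ext_ae ?_
  filter_upwards [h1, h2, h3, h4, h5, h6, coeFn_kineticGrad lam (evalP p v t - evalP p u t),
    coeFn_sub (evalP p v t) (evalP p u t)] with x g1 g2 g3 g4 g5 g6 g7 g8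
  rw [g1, g2, g3, g6, g7, g8, g4, g5]
  rfl

theorem eq_of_evalP_ae_eq {u v : VarLp (p.ext ν)} (h : ∀ᵐ t ∂ν, evalP p u t = evalP p v t) :
    u = v := by
  have h0 : (p.ext ν).modular (u - v : VarLp (p.ext ν)) = 0 := by
    rw [modular_ext_eq p (VarLp.aemeasurable _), ← lintegral_zero (μ := ν)]
    refine lintegral_congr_ae ?_
    filter_upwards [h, evalP_sub u v, evalP_coeFn p (u - v)] with t h1 h2 h3
    rw [← p.modular_congr h3, h2, h1, modular_sub_eq]
    simp only [sub_self]
    exact p.modular_zero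
  rw [← sub_eq_zero, ← norm_le_zero_iff]
  refine le_of_forall_pos_le_add fun ε hε => ?_
  obtain ⟨δ, _, hd⟩ := exists_norm_le_of_modular_le (p.ext ν) hε
  rw [zero_add]
  exact hd _ (by rw [h0]; exact zero_le)

/-- By separability U is a countable union of modular balls around dense points. Their preimages are
null measurable by Tonelli, because the modular of a slice is an inner integral. -/
theorem nullMeasurableSet_evalP_preimage [SecondCountableTopology (VarLp p)]
    (u : VarLp (p.ext ν)) {U : Set (VarLp p)} (hU : IsOpen U) :
    NullMeasurableSet (evalP p u ⁻¹' U) ν := by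
  let d := TopologicalSpace.denseSeq (VarLp p)
  let B : ℕ × ℕ → Set (VarLp p) := fun j =>
    {v | p.modular (((j.2 : ℝ) + 1) • (v - d j.1) : VarLp p) < 1}
  have hB : ∀ j, NullMeasurableSet (evalP p u ⁻¹' B j) ν := fun j => by
    refine nullMeasurableSet_lt (α := ℝ≥0∞) ?_ aemeasurable_const
    have hf : AEMeasurable (fun z : α × τ => ((j.2 : ℝ) + 1) * (u z - d j.1 z.1)) (μ.prod ν) :=
      ((VarLp.aemeasurable u).sub (VarLp.aemeasurable (d j.1)).comp_fst).const_mul _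
    refine (aemeasurable_modular_slice p hf).congr ?_
    filter_upwards [evalP_coeFn p u] with t ht
    refine p.modular_congr ?_
    filter_upwards [ht, coeFn_smul ((j.2 : ℝ) + 1) (evalP p u t - d j.1),
      coeFn_sub (evalP p u t) (d j.1)] with x h1 h2 h3
    rw [h2, h3, h1]
  have hUeq : U = ⋃ j ∈ {j | B j ⊆ U}, B j := by
    refine Subset.antisymm (fun v hv => ?_) (iUnion₂_subset fun j hj => hj)
    obtain ⟨r, hr, hball⟩ := Metric.isOpen_iff.1 hU v hv
    obtain ⟨n, hn⟩ := exists_nat_one_div_lt (half_pos hr)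
    have hn0 : (0 : ℝ) < n + 1 := by positivity
    obtain ⟨i, hi⟩ := (TopologicalSpace.denseRange_denseSeq (VarLp p)).exists_dist_lt v
      (show 0 < min (1 / (2 * ((n : ℝ) + 1))) (r / 2) by positivity)
    rw [dist_eq_norm, lt_min_iff] at hi
    have hnorm : ∀ y : VarLp p, ‖((n : ℝ) + 1) • y‖ = ((n : ℝ) + 1) * ‖y‖ := fun y => by
      rw [norm_smul, Real.norm_of_nonneg hn0.le]
    refine mem_iUnion₂.2 ⟨(i, n), fun y hy => hball ?_, ?_⟩
    · have hy' : p.modular (((n : ℝ) + 1) • (y - d i) : VarLp p) < 1 := hy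
      have h1 : ‖((n : ℝ) + 1) • (y - d i)‖ ≤ 1 :=
        norm_le_of_modular one_pos (by simpa only [inv_one, one_mul] using hy'.le)
      rw [hnorm, ← le_div_iff₀' hn0] at h1
      rw [mem_ball_iff_norm]
      have h2 : ‖y - v‖ ≤ ‖y - d i‖ + ‖v - d i‖ := by
        rw [← sub_sub_sub_cancel_right y v (d i)]
        exact norm_sub_le _ _
      linarith [hi.2]
    · have h1 : ‖((n : ℝ) + 1) • (v - d i)‖ < 1 / 2 := by
        rw [hnorm, ← lt_div_iff₀' hn0, div_div]
        exact hi.1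
      refine (modular_le_of_norm_lt h1 (by norm_num)).trans_lt ?_
      rw [← ENNReal.ofReal_one]
      exact (ENNReal.ofReal_lt_ofReal_iff one_pos).2 (by norm_num)
  rw [hUeq, preimage_iUnion₂]
  exact NullMeasurableSet.biUnion (to_countable _) fun j _ => hB j

/-! ### Convexity and lower semicontinuity of the time integral. -/

variable {φ : VarLp p → ℝ≥0∞}

theorem aemeasurable_comp_evalP [SecondCountableTopology (VarLp p)]
    (hlsc : LowerSemicontinuous φ) (u : VarLp (p.ext ν)) :
    AEMeasurable (fun t => φ (evalP p u t)) ν := by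
  refine NullMeasurable.aemeasurable ?_
  refine measurable_of_Ioi (δ := NullMeasurableSpace τ ν) fun y => ?_
  exact nullMeasurableSet_evalP_preimage u (hlsc.isOpen_preimage y)

/-- Measurability in t is automatic, so the default value ∞ is used only where the integral is
itself infinite. -/
theorem timeIntegral_eq [SecondCountableTopology (VarLp p)]
    (hlsc : LowerSemicontinuous φ) (u : VarLp (p.ext ν)) :
    timeIntegral ν φ u = ∫⁻ t, φ (evalP p u t) ∂ν := by
  rw [timeIntegral]
  split_ifs with h
  · rfl
  · by_contra hne
    exact h ⟨aemeasurable_comp_evalP hlsc u, lt_top_iff_ne_top.2 (Ne.symm hne)⟩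

theorem convexOn_timeIntegral [SecondCountableTopology (VarLp p)]
    (hconv : ConvexOn ℝ≥0 univ φ) (hlsc : LowerSemicontinuous φ) :
    ConvexOn ℝ≥0 univ (timeIntegral ν φ) := by
  refine ⟨convex_univ, fun u _ v _ a b _ _ hab => ?_⟩
  rw [timeIntegral_eq hlsc, timeIntegral_eq hlsc, timeIntegral_eq hlsc, ENNReal.smul_def,
    ENNReal.smul_def, smul_eq_mul, smul_eq_mul, ← lintegral_const_mul' _ _ ENNReal.coe_ne_top,
    ← lintegral_const_mul' _ _ ENNReal.coe_ne_top,
    ← lintegral_add_left' ((aemeasurable_comp_evalP hlsc u).const_mul _)]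
  refine lintegral_mono_ae ?_
  filter_upwards [evalP_smul_add_smul (a : ℝ) (b : ℝ) u v] with t ht
  have h1 : evalP p (a • u + b • v) t = a • evalP p u t + b • evalP p v t := ht
  rw [h1]
  exact hconv.2 (mem_univ _) (mem_univ _) zero_le zero_le hab

/-- The modulars are summable, so by Tonelli the sum of the slice modulars is finite for a.e. t and
its terms tend to zero. -/
theorem ae_tendsto_evalP {f : ℕ → VarLp (p.ext ν)} {u : VarLp (p.ext ν)}
    (h : ∀ n, (p.ext ν).modular (fun z => f n z - u z) ≤ 2⁻¹ ^ n) :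
    ∀ᵐ t ∂ν, Tendsto (fun n => evalP p (f n) t) atTop (𝓝 (evalP p u t)) := by
  have hm : ∀ n, AEMeasurable (fun z => f n z - u z) (μ.prod ν) := fun n =>
    (VarLp.aemeasurable (f n)).sub (VarLp.aemeasurable u)
  have hsum : ∫⁻ t, ∑' n, p.modular (fun x => f n (x, t) - u (x, t)) ∂ν ≠ ∞ := by
    rw [lintegral_tsum fun n => aemeasurable_modular_slice p (hm n)]
    simp_rw [← modular_ext_eq p (hm _)]
    refine ((ENNReal.tsum_le_tsum h).trans_lt ?_).ne
    rw [ENNReal.tsum_geometric_two]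
    exact ENNReal.ofNat_lt_top
  have hlt := ae_lt_top' (AEMeasurable.tsum fun n => aemeasurable_modular_slice p (hm n)) hsum
  filter_upwards [hlt, ae_all_iff.2 fun n => evalP_coeFn p (f n), evalP_coeFn p u] with t h1 h2 h3
  rw [tendsto_iff_modular]
  refine (ENNReal.tendsto_atTop_zero_of_tsum_ne_top h1.ne).congr fun n => p.modular_congr ?_
  filter_upwards [h2 n, h3] with x g1 g2
  rw [g1, g2]

/-- A failure would give v n converging to u at a geometric rate with values at most y. Slices then
converge a.e., and lower semicontinuity of φ with Fatou's lemma contradicts y < Φ(u). -/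
theorem lowerSemicontinuous_timeIntegral [SecondCountableTopology (VarLp p)]
    (hlsc : LowerSemicontinuous φ) : LowerSemicontinuous (timeIntegral (p := p) ν φ) := by
  intro u y hy
  by_contra hne
  have hfreq : ∃ᶠ v in 𝓝 u, timeIntegral ν φ v ≤ y := by
    refine (Filter.not_eventually.1 hne).mono fun v hv => not_lt.1 hv
  have hex : ∀ n : ℕ, ∃ v : VarLp (p.ext ν), timeIntegral ν φ v ≤ y ∧
      (p.ext ν).modular (fun z => v z - u z) ≤ 2⁻¹ ^ n := fun n => by
    have hnhds := ENNReal.tendsto_nhds_zero.1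
      (tendsto_iff_modular.1 (tendsto_id (x := 𝓝 u))) (2⁻¹ ^ n)
      (ENNReal.pow_pos (by simp) n)
    exact (hfreq.and_eventually hnhds).exists
  choose v hv hmod using hex
  have hle : timeIntegral ν φ u ≤ y := by
    calc timeIntegral ν φ u = ∫⁻ t, φ (evalP p u t) ∂ν := timeIntegral_eq hlsc u
      _ ≤ ∫⁻ t, liminf (fun n => φ (evalP p (v n) t)) atTop ∂ν := by
        refine lintegral_mono_ae ?_
        filter_upwards [ae_tendsto_evalP hmod] with t ht
        refine le_of_forall_lt fun c hc => ?_
        obtain ⟨c', hc1, hc2⟩ := exists_between hc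
        refine hc1.trans_le (le_liminf_of_le (by isBoundedDefault) ?_)
        exact (ht.eventually (hlsc _ c' hc2)).mono fun n hn => hn.le
      _ ≤ liminf (fun n => ∫⁻ t, φ (evalP p (v n) t) ∂ν) atTop :=
        lintegral_liminf_le' fun n => aemeasurable_comp_evalP hlsc (v n)
      _ ≤ y := by
        refine liminf_le_of_frequently_le'
          (Eventually.frequently (Eventually.of_forall fun n => ?_))
        rw [← timeIntegral_eq hlsc]
        exact hv n
  exact absurd hy (not_lt.2 hle)

theorem yosidaObjective_timeIntegral [SecondCountableTopology (VarLp p)] (lam : ℝ)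
    (hlsc : LowerSemicontinuous φ) (u v : VarLp (p.ext ν)) :
    AEMeasurable (fun t => yosidaObjective lam φ (evalP p u t) (evalP p v t)) ν ∧
    yosidaObjective lam (timeIntegral ν φ) u v =
      ∫⁻ t, yosidaObjective lam φ (evalP p u t) (evalP p v t) ∂ν := by
  have hm : AEMeasurable (fun z : α × τ =>
      ENNReal.ofReal (lam / (p.ext ν) z * |(v z - u z) / lam| ^ (p.ext ν) z)) (μ.prod ν) :=
    (aemeasurable_density lam (p.ext ν)
      ((VarLp.aemeasurable v).sub (VarLp.aemeasurable u))).ennreal_ofReal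
  have hslice : (fun t => ∫⁻ x, ENNReal.ofReal
      (lam / (p.ext ν) (x, t) * |(v (x, t) - u (x, t)) / lam| ^ (p.ext ν) (x, t)) ∂μ) =ᵐ[ν]
      fun t => ∫⁻ x, ENNReal.ofReal
        (lam / p x * |(evalP p v t x - evalP p u t x) / lam| ^ p x) ∂μ := by
    filter_upwards [evalP_coeFn p u, evalP_coeFn p v] with t h1 h2
    refine lintegral_congr_ae ?_
    filter_upwards [h1, h2] with x g1 g2
    rw [g1, g2]
    rfl
  have hm' := hm.lintegral_prod_left'.congr hslice
  refine ⟨hm'.add (aemeasurable_comp_evalP hlsc v), ?_⟩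
  simp only [yosidaObjective]
  rw [lintegral_add_left' hm', lintegral_prod_symm _ hm, lintegral_congr_ae hslice,
    timeIntegral_eq hlsc]

theorem integral_mul_sub_eq (ξ : VarLp (p.ext ν).conj) (u v : VarLp (p.ext ν)) :
    Integrable (fun t => pairing (evalP p.conj ξ t) (evalP p v t - evalP p u t)) ν ∧
    ∫ z, ξ z * (v z - u z) ∂(μ.prod ν) =
      ∫ t, pairing (evalP p.conj ξ t) (evalP p v t - evalP p u t) ∂ν := by
  have hint : Integrable (fun z => ξ z * (v z - u z)) (μ.prod ν) := by
    refine (integrable_mul (p.ext ν).holderConjugate_conj (v - u) ξ).congr ?_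
    filter_upwards [coeFn_sub v u] with z hz
    rw [hz, mul_comm]
  have hslice : (fun t => ∫ x, ξ (x, t) * (v (x, t) - u (x, t)) ∂μ) =ᵐ[ν]
      fun t => pairing (evalP p.conj ξ t) (evalP p v t - evalP p u t) := by
    filter_upwards [evalP_coeFn p u, evalP_coeFn p v, evalP_coeFn (ν := ν) p.conj ξ]
      with t h1 h2 h3
    rw [← integral_mul_sub]
    refine integral_congr_ae ?_
    filter_upwards [h1, h2, h3] with x g1 g2 g3
    rw [g1, g2, g3]
  exact ⟨hint.integral_prod_right.congr hslice, by
    rw [integral_prod_symm _ hint, integral_congr_ae hslice]⟩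

/-! ### Localization in time of subgradients and minimizers. -/

variable [IsFiniteMeasure ν]

/-- These are the competitors that localize in time. Finiteness of ν puts the function constantly
equal to w in time into the space. -/
theorem exists_piecewise (w : VarLp p) (u : VarLp (p.ext ν)) {A : Set τ} (hA : MeasurableSet A) :
    ∃ v : VarLp (p.ext ν), ∀ᵐ t ∂ν, (t ∈ A → evalP p v t = w) ∧
      (t ∉ A → evalP p v t = evalP p u t) := by
  classical
  have hwm : AEStronglyMeasurable (fun z : α × τ => w z.1) (μ.prod ν) :=
    (aestronglyMeasurable w).comp_fst
  have hS : MeasurableSet (Prod.snd ⁻¹' A : Set (α × τ)) := measurable_snd hA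
  have hm : AEStronglyMeasurable ((Prod.snd ⁻¹' A : Set (α × τ)).piecewise (fun z => w z.1) u)
      (μ.prod ν) :=
    AEStronglyMeasurable.piecewise hS hwm.restrict (aestronglyMeasurable u).restrict
  have hw : (p.ext ν).modular (fun z => w z.1) < ∞ := by
    rw [modular_ext_eq p hwm.aemeasurable]
    simp only [lintegral_const]
    exact ENNReal.mul_lt_top (modular_lt_top w) (measure_lt_top _ _)
  have hfin : (p.ext ν).modular
      ((Prod.snd ⁻¹' A : Set (α × τ)).piecewise (fun z => w z.1) u) < ∞ := by
    refine lt_of_le_of_lt ?_ (ENNReal.add_lt_top.2 ⟨hw, modular_lt_top u⟩)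
    unfold VarExponent.modular
    rw [← lintegral_add_left' ((p.ext ν).aemeasurable_pow hwm.aemeasurable)]
    refine lintegral_mono fun z => ?_
    by_cases hz : z ∈ (Prod.snd ⁻¹' A : Set (α × τ))
    · rw [piecewise_eq_of_mem _ _ _ hz]
      exact le_self_add
    · rw [piecewise_eq_of_notMem _ _ _ hz]
      exact le_add_self
  refine ⟨VarLp.of _ hm hfin, ?_⟩
  filter_upwards [evalP_ae_eq (coeFn_of (p := p.ext ν) _ hm hfin), evalP_coeFn p u] with t h1 h2
  refine ⟨fun ht => ext_ae ?_, fun ht => ext_ae ?_⟩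
  · filter_upwards [h1] with x g1
    rw [g1, piecewise_eq_of_mem _ _ _ (show (x, t) ∈ (Prod.snd ⁻¹' A : Set (α × τ)) from ht)]
  · filter_upwards [h1, h2] with x g1 g2
    rw [g1, piecewise_eq_of_notMem _ _ _
      (show (x, t) ∉ (Prod.snd ⁻¹' A : Set (α × τ)) from ht), g2]

theorem exists_timeIntegral_ne_top [SecondCountableTopology (VarLp p)]
    (hlsc : LowerSemicontinuous φ) (hproper : ∃ v, φ v ≠ ∞) :
    ∃ v : VarLp (p.ext ν), timeIntegral ν φ v ≠ ∞ := by
  obtain ⟨w, hw⟩ := hproper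
  obtain ⟨v, hv⟩ := exists_piecewise (ν := ν) w 0 MeasurableSet.univ
  refine ⟨v, ?_⟩
  have h1 : ∫⁻ t, φ (evalP p v t) ∂ν = ∫⁻ _, φ w ∂ν := by
    refine lintegral_congr_ae ?_
    filter_upwards [hv] with t ht
    rw [ht.1 (mem_univ t)]
  rw [timeIntegral_eq hlsc, h1, lintegral_const]
  exact ENNReal.mul_ne_top hw (measure_ne_top _ _)

/-- The competitor equal to w on A and to v elsewhere makes both sides of the subgradient inequality
integrals over A. As A is an arbitrary measurable set, the integrands are ordered a.e. -/
theorem ae_pairing_evalP_le [SecondCountableTopology (VarLp p)] (hlsc : LowerSemicontinuous φ)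
    {v : VarLp (p.ext ν)} {ξ : VarLp (p.ext ν).conj} (hξ : ξ ∈ subdiff (timeIntegral ν φ) v)
    {w : VarLp p} (hw : φ w ≠ ∞) :
    ∀ᵐ t ∂ν, pairing (evalP p.conj ξ t) (w - evalP p v t) ≤
      (φ w).toReal - (φ (evalP p v t)).toReal := by
  obtain ⟨hv, hsub⟩ := hξ
  have hfin : ∀ y : VarLp (p.ext ν), timeIntegral ν φ y ≠ ∞ →
      (∀ᵐ t ∂ν, φ (evalP p y t) < ∞) ∧ Integrable (fun t => (φ (evalP p y t)).toReal) ν ∧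
      (timeIntegral ν φ y).toReal = ∫ t, (φ (evalP p y t)).toReal ∂ν := fun y hy => by
    have hm := aemeasurable_comp_evalP hlsc y
    rw [timeIntegral_eq hlsc] at hy
    have hlt := ae_lt_top' hm hy
    exact ⟨hlt, integrable_toReal_of_lintegral_ne_top hm hy, by
      rw [timeIntegral_eq hlsc, integral_toReal hm hlt]⟩
  obtain ⟨hvlt, hvint, hvreal⟩ := hfin v hv
  have hint : Integrable (fun t => pairing (evalP p.conj ξ t) (w - evalP p v t)) ν := by
    obtain ⟨y, hy⟩ := exists_piecewise w v MeasurableSet.univ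
    refine (integral_mul_sub_eq ξ v y).1.congr ?_
    filter_upwards [hy] with t ht
    rw [ht.1 (mem_univ t)]
  refine ae_le_of_forall_setIntegral_le hint ((integrable_const _).sub hvint) fun A hA _ => ?_
  obtain ⟨y, hy⟩ := exists_piecewise w v hA
  have hyfin : timeIntegral ν φ y ≠ ∞ := by
    rw [timeIntegral_eq hlsc] at hv ⊢
    have hle : ∫⁻ t, φ (evalP p y t) ∂ν ≤ ∫⁻ t, (φ w + φ (evalP p v t)) ∂ν := by
      refine lintegral_mono_ae ?_
      filter_upwards [hy] with t ht
      by_cases htA : t ∈ A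
      · rw [ht.1 htA]
        exact le_self_add
      · rw [ht.2 htA]
        exact le_add_self
    refine (hle.trans_lt ?_).ne
    rw [lintegral_add_left measurable_const, lintegral_const]
    exact ENNReal.add_lt_top.2
      ⟨ENNReal.mul_lt_top hw.lt_top (measure_lt_top _ _), hv.lt_top⟩
  obtain ⟨_, hyint, hyreal⟩ := hfin y hyfin
  have h1 := hsub y hyfin
  rw [(integral_mul_sub_eq ξ v y).2, hyreal, hvreal, ← integral_sub hyint hvint] at h1
  have e1 : (fun t => pairing (evalP p.conj ξ t) (evalP p y t - evalP p v t)) =ᵐ[ν]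
      A.indicator fun t => pairing (evalP p.conj ξ t) (w - evalP p v t) := by
    filter_upwards [hy] with t ht
    by_cases htA : t ∈ A
    · rw [ht.1 htA, indicator_of_mem htA]
    · rw [ht.2 htA, indicator_of_notMem htA, sub_self, map_zero]
  have e2 : (fun t => (φ (evalP p y t)).toReal - (φ (evalP p v t)).toReal) =ᵐ[ν]
      A.indicator fun t => (φ w).toReal - (φ (evalP p v t)).toReal := by
    filter_upwards [hy] with t ht
    by_cases htA : t ∈ A
    · rw [ht.1 htA, indicator_of_mem htA]
    · rw [ht.2 htA, indicator_of_notMem htA, sub_self]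
  rwa [integral_congr_ae e1, integral_congr_ae e2, integral_indicator hA,
    integral_indicator hA] at h1

/-- A subgradient of the time integral of `φ` is a subgradient of `φ` at almost every time. -/
theorem ae_evalP_mem_subdiff [SecondCountableTopology (VarLp p)] (hlsc : LowerSemicontinuous φ)
    {v : VarLp (p.ext ν)} {ξ : VarLp (p.ext ν).conj} (hξ : ξ ∈ subdiff (timeIntegral ν φ) v) :
    ∀ᵐ t ∂ν, evalP p.conj ξ t ∈ subdiff φ (evalP p v t) := by
  obtain ⟨D, hD, hDfin, htest⟩ := exists_countable_subdiff_test φ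
  have hv := hξ.1
  rw [timeIntegral_eq hlsc] at hv
  -- Countability of D gives one null set of times serving all test points.
  filter_upwards [ae_lt_top' (aemeasurable_comp_evalP hlsc v) hv,
    (ae_ball_iff hD).2 fun w hw => ae_pairing_evalP_le hlsc hξ (hDfin w hw)] with t h1 h2
  exact htest _ _ h1.ne h2

/-- A minimizer for the time integral of `φ` is a minimizer for `φ` at almost every time. -/
theorem ae_moreauYosida_evalP_eq [SecondCountableTopology (VarLp p)] {lam : ℝ} (hlam : 0 < lam)
    (hproper : ∃ v, φ v ≠ ∞) (hconv : ConvexOn ℝ≥0 univ φ) (hlsc : LowerSemicontinuous φ)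
    {u v : VarLp (p.ext ν)}
    (hmin : moreauYosida lam (timeIntegral ν φ) u = yosidaObjective lam (timeIntegral ν φ) u v) :
    ∀ᵐ t ∂ν, moreauYosida lam φ (evalP p u t) =
      yosidaObjective lam φ (evalP p u t) (evalP p v t) := by
  have hmem := neg_kineticGrad_mem_subdiff hlam (convexOn_timeIntegral hconv hlsc)
    (exists_timeIntegral_ne_top hlsc hproper) hmin
  filter_upwards [ae_evalP_mem_subdiff hlsc hmem, evalP_neg_kineticGrad lam u v] with t h1 h2
  rw [h2] at h1
  exact moreauYosida_eq_of_mem_subdiff hlam h1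

end TimeSlices

end

theorem lemma4p2 (N : ℕ) (Ω : Set (EuclideanSpace ℝ (Fin N))) (hΩ : IsOpen Ω)
    (T : ℝ) (hT : 0 < T)
    (p : VarExponent (volume.restrict Ω))
    (φ : VarLp p → ℝ≥0∞) (hproper : ∃ v, φ v ≠ ∞) (hconv : ConvexOn ℝ≥0 univ φ)
    (hlsc : LowerSemicontinuous φ) (lam : ℝ) (hlam : 0 < lam) :
    -- the two regularizations are finite and the infima defining them are minima
    (∀ w : VarLp p, moreauYosida lam φ w ≠ ∞ ∧
      ∃ v, moreauYosida lam φ w = yosidaObjective lam φ w v) ∧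
    (∀ u : VarLp (p.ext (timeMeasure T)), moreauYosida lam (timeIntegral (timeMeasure T) φ) u ≠ ∞ ∧
      ∃ v, moreauYosida lam (timeIntegral (timeMeasure T) φ) u
        = yosidaObjective lam (timeIntegral (timeMeasure T) φ) u v) ∧
    -- regularization commutes with integration in time
    (∀ u : VarLp (p.ext (timeMeasure T)),
      AEMeasurable (fun t => moreauYosida lam φ (evalP p u t)) (timeMeasure T) ∧
      moreauYosida lam (timeIntegral (timeMeasure T) φ) u
        = ∫⁻ t in Ioo 0 T, moreauYosida lam φ (evalP p u t)) ∧
    -- the subdifferentials of the two regularizations are single-valued and defined everywhere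
    (∀ w : VarLp p, ∃ η, subdiff (moreauYosida lam φ) w = {η}) ∧
    (∀ u : VarLp (p.ext (timeMeasure T)),
      ∃ ξ, subdiff (moreauYosida lam (timeIntegral (timeMeasure T) φ)) u = {ξ}) ∧
    -- the subdifferential of the regularization is computed pointwise in time
    (∀ (u : VarLp (p.ext (timeMeasure T))) (ξ : VarLp (p.ext (timeMeasure T)).conj),
      subdiff (moreauYosida lam (timeIntegral (timeMeasure T) φ)) u = {ξ} ↔
        ∀ᵐ t ∂(timeMeasure T),
          subdiff (moreauYosida lam φ) (evalP p u t) = {evalP p.conj ξ t}) := by 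
  have hsep : SecondCountableTopology (VarLp p) := inferInstance
  have hΦconv := convexOn_timeIntegral (ν := timeMeasure T) hconv hlsc
  have hΦlsc := lowerSemicontinuous_timeIntegral (ν := timeMeasure T) hlsc
  have hΦproper := exists_timeIntegral_ne_top (ν := timeMeasure T) hlsc hproper
  have hmin := VarLp.exists_moreauYosida_eq hlam hΦconv hΦlsc hΦproper
  refine ⟨fun w => ⟨VarLp.moreauYosida_ne_top hlam hproper w,
      VarLp.exists_moreauYosida_eq hlam hconv hlsc hproper w⟩,
    fun u => ⟨VarLp.moreauYosida_ne_top hlam hΦproper u, hmin u⟩, fun u => ?_, fun w => ?_,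
    fun u => ?_, fun u ξ => ?_⟩
  · obtain ⟨v, hv⟩ := hmin u
    have hae := ae_moreauYosida_evalP_eq hlam hproper hconv hlsc hv
    obtain ⟨h1, h2⟩ := yosidaObjective_timeIntegral lam hlsc u v
    -- Measurability of the regularization in t is inherited from the objective along the slices of
    -- the single minimizer v.
    exact ⟨h1.congr (hae.mono fun t ht => ht.symm), by rw [hv, h2, lintegral_congr_ae hae]⟩
  · obtain ⟨v, hv⟩ := VarLp.exists_moreauYosida_eq hlam hconv hlsc hproper w
    exact ⟨_, VarLp.subdiff_moreauYosida_eq hlam hconv hlsc hproper hv⟩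
  · obtain ⟨v, hv⟩ := hmin u
    exact ⟨_, VarLp.subdiff_moreauYosida_eq hlam hΦconv hΦlsc hΦproper hv⟩
  · obtain ⟨v, hv⟩ := hmin u
    rw [VarLp.subdiff_moreauYosida_eq hlam hΦconv hΦlsc hΦproper hv, singleton_eq_singleton_iff]
    -- The slices of the subgradient on Q are the subgradients on Ω. The equivalence then reduces to
    -- the fact that a class on Q is determined by almost all its slices.
    have hae : ∀ᵐ t ∂(timeMeasure T), subdiff (moreauYosida lam φ) (evalP p u t) =
        {evalP p.conj (-VarLp.kineticGrad lam (v - u) : VarLp (p.ext (timeMeasure T)).conj) t} := by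
      filter_upwards [ae_moreauYosida_evalP_eq hlam hproper hconv hlsc hv,
        evalP_neg_kineticGrad lam u v] with t h1 h2
      rw [VarLp.subdiff_moreauYosida_eq hlam hconv hlsc hproper h1, h2]
    constructor
    · rintro rfl
      exact hae
    · intro h
      refine eq_of_evalP_ae_eq (p := p.conj) (ν := timeMeasure T) ?_
      filter_upwards [hae, h] with t h1 h2
      exact singleton_eq_singleton_iff.1 (h1.symm.trans h2)
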